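/- Let $n\ge 1$, let $(V,\omega)$ be a real symplectic vector space of dimension $2n$, and let $J$ be a complex structure on $V$ compatible with $\omega$, i.e. $J^2=-1$, $\omega(Jx,Jy)=\omega(x,y)$ and $\omega(x,Jx)>0$ for $x\ne 0$. Call an alternating $n$-form $\Omega:V^n\to\mathbb C$ (multilinear over $\mathbb R$) primitive if $\omega\wedge\Omega=0$, and let $\mathcal U(V)$ be the space of primitive forms $\Omega$ with $\Omega|_L\neq 0$ for every Lagrangian subspace $L\subset V$, with the subspace topology from the finite-dimensional vector space of $\mathbb C$-valued $n$-forms. Each $\Omega\in\mathcal U(V)$ defines a phase map $\phi_\Omega:\mathrm{LGr}(V)\to\mathbb R/\pi\mathbb Z$, $L\mapsto\mathrm{Arg}(\Omega|_L)$, on the Lagrangian Grassmannian. Let $\mathcal U^+(V)\subset\mathcal U(V)$ be the set of those $\Omega$ for which $\phi_\Omega$ sends the canonical generator of $\pi_1(\mathrm{LGr}(V))\cong\mathbb Z$ to a positive element of $\pi_1(\mathbb R/\pi\mathbb Z)\cong\mathbb Z$; here the canonical generator is the class of the loop $\mathbb R/\pi\mathbb Z\to\mathrm{LGr}(V)$,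 $\theta\mapsto e^{i\theta}\mathbb R\times\mathbb R^{n-1}$, for a linear identification of $(V,\omega)$ with $\mathbb C^n$, $\sum_j dx_j\wedge dy_j$ (the class does not depend on the identification). Let $\Lambda^{k,n-k}V^\vee$ be the space of $n$-forms of type $(k,n-k)$ with respect to $J$. Then: 1. $\Lambda^{n,0}V^\vee\setminus\{0\}$ is contained in $\mathcal U^+(V)$, and $\mathcal U^+(V)$ deformation retracts onto $\Lambda^{n,0}V^\vee\setminus\{0\}$, by a homotopy that fixes $\Lambda^{n,0}V^\vee\setminus\{0\}$ pointwise at all times. 2. $\mathcal U^+(V)$ is homotopy equivalent to $S^1$. 3. Let $\Omega\in\mathcal U^+(V)$ and let $\Omega=\sum_{k=0}^n\Omega^{k,n-k}$ be its unique decomposition into forms $\Omega^{k,n-k}\in\Lambda^{k,n-k}V^\vee$. For every basis $v_1,\dots,v_n$ of every Lagrangian subspace of $V$, the polynomial $p(z)=\sum_{k=0}^n\Omega^{k,n-k}(v_1,\dots,v_n)\,z^k$ has degree exactly $n$, and all its roots lie in the open unit disk. -/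

import Mathlib

open scoped unitInterval

namespace LagForms

noncomputable section

variable {V : Type*} [AddCommGroup V] [Module ℝ V] {n : ℕ}

/-- `ω` is a symplectic form, i.e. a nondegenerate alternating bilinear form. -/
def IsSymplectic (ω : V [⋀^Fin 2]→ₗ[ℝ] ℝ) : Prop :=
  ∀ x : V, (∀ y : V, ω ![x, y] = 0) → x = 0

/-- `J` is a complex structure compatible with `ω`: `J² = -1`, `ω(Jx, Jy) = ω(x, y)`, and
`ω(x, Jx) > 0` for `x ≠ 0`. -/
structure IsCompatible (ω : V [⋀^Fin 2]→ₗ[ℝ] ℝ) (J : V →ₗ[ℝ] V) : Prop where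
  sq_eq_neg : ∀ x : V, J (J x) = -x
  invariant : ∀ x y : V, ω ![J x, J y] = ω ![x, y]
  pos : ∀ x : V, x ≠ 0 → 0 < ω ![x, J x]

/-- The topology of pointwise convergence on `ℂ`-valued alternating forms. If `V` is
finite-dimensional this is the usual topology of a finite-dimensional real vector space (the only
Hausdorff vector space topology). -/
instance formTopology : TopologicalSpace (V [⋀^Fin n]→ₗ[ℝ] ℂ) :=
  TopologicalSpace.induced (fun Ω (v : Fin n → V) => Ω v) inferInstance

/-- The exterior product `ω ∧ Ω`. -/
def wedge (ω : V [⋀^Fin 2]→ₗ[ℝ] ℝ) (Ω : V [⋀^Fin n]→ₗ[ℝ] ℂ) :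
    V [⋀^Fin 2 ⊕ Fin n]→ₗ[ℝ] ℂ :=
  (TensorProduct.lid ℝ ℂ).toLinearMap.compAlternatingMap (ω.domCoprod Ω)

/-- A form `Ω` of degree `n` on a symplectic space of dimension `2 n` is primitive if
`ω ∧ Ω = 0`. -/
def IsPrimitive (ω : V [⋀^Fin 2]→ₗ[ℝ] ℝ) (Ω : V [⋀^Fin n]→ₗ[ℝ] ℂ) : Prop :=
  wedge ω Ω = 0

/-- The Lagrangian Grassmannian of a symplectic space of dimension `2 n`: isotropic subspaces of
dimension `n`. -/
def LGr (ω : V [⋀^Fin 2]→ₗ[ℝ] ℝ) (n : ℕ) : Type _ :=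
  {L : Submodule ℝ V // (∀ x ∈ L, ∀ y ∈ L, ω ![x, y] = 0) ∧ Module.finrank ℝ L = n}

/-- The space `𝒰(V)` of primitive `ℂ`-valued `n`-forms whose restriction to any Lagrangian subspace
is nonzero. -/
def U (ω : V [⋀^Fin 2]→ₗ[ℝ] ℝ) (n : ℕ) : Set (V [⋀^Fin n]→ₗ[ℝ] ℂ) :=
  {Ω | IsPrimitive ω Ω ∧ ∀ L : LGr ω n, Ω.compLinearMap L.1.subtype ≠ 0}

/-- A basis of a Lagrangian subspace for `1 ≤ n`. -/
def LGr.basis [NeZero n] {ω : V [⋀^Fin 2]→ₗ[ℝ] ℝ} (L : LGr ω n) : Module.Basis (Fin n) ℝ L.1 :=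
  haveI : FiniteDimensional ℝ L.1 :=
    FiniteDimensional.of_finrank_pos (by rw [L.2.2]; exact Nat.pos_of_ne_zero (NeZero.ne n))
  Module.finBasisOfFinrankEq ℝ L.1 L.2.2

/-- The phase map `φ_Ω : LGr(V) → ℝ/πℤ`, `L ↦ Arg (Ω|_L)`, where `Ω|_L` is a complex number up to
nonzero real factors, after evaluation at a basis of `L`. -/
def phase [NeZero n] {ω : V [⋀^Fin 2]→ₗ[ℝ] ℝ} (Ω : V [⋀^Fin n]→ₗ[ℝ] ℂ) (L : LGr ω n) :
    AddCircle Real.pi :=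
  ((Ω fun i => (L.basis i : V)).arg : ℝ)

/-- `e, f` is a symplectic basis of a symplectic space of dimension `2 n`, in other words,
`x_j + i y_j ↦ x_j e_j + y_j f_j` is a symplectic identification with the standard `ℂⁿ`. (These
relations imply that the `2 n` vectors are linearly independent.) -/
structure IsSymplecticBasis (ω : V [⋀^Fin 2]→ₗ[ℝ] ℝ) (e f : Fin n → V) : Prop where
  ee : ∀ i j, ω ![e i, e j] = 0
  ff : ∀ i j, ω ![f i, f j] = 0
  ef : ∀ i j, ω ![e i, f j] = if i = j then 1 else 0

/-- The frame `cos θ e₀ + sin θ f₀, e₁, …, eₙ₋₁`, which is `e^{iθ}, 1, …, 1` in the coordinates of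
`ℂⁿ`. -/
def stdFrame [NeZero n] (e f : Fin n → V) (θ : ℝ) : Fin n → V :=
  Function.update e 0 (Real.cos θ • e 0 + Real.sin θ • f 0)

theorem form_add_right (ω : V [⋀^Fin 2]→ₗ[ℝ] ℝ) (x y y' : V) :
    ω ![x, y + y'] = ω ![x, y] + ω ![x, y'] := by
  have h : ∀ z : V, Function.update ![x, 0] 1 z = ![x, z] := fun z => by
    ext i; fin_cases i <;> simp
  have := ω.map_update_add ![x, 0] 1 y y'
  rwa [h, h, h] at this

theorem form_smul_right (ω : V [⋀^Fin 2]→ₗ[ℝ] ℝ) (c : ℝ) (x y : V) :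
    ω ![x, c • y] = c • ω ![x, y] := by
  have h : ∀ z : V, Function.update ![x, 0] 1 z = ![x, z] := fun z => by
    ext i; fin_cases i <;> simp
  have := ω.map_update_smul ![x, 0] 1 c y
  rwa [h, h] at this

/-- The bilinear form `(x, y) ↦ ω(x, y)`. -/
def toBilin (ω : V [⋀^Fin 2]→ₗ[ℝ] ℝ) : V →ₗ[ℝ] V →ₗ[ℝ] ℝ :=
  LinearMap.mk₂ ℝ (fun x y => ω ![x, y])
    (fun x x' y => ω.map_vecCons_add ![y] x x')
    (fun c x y => ω.map_vecCons_smul ![y] c x)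
    (form_add_right ω)
    (form_smul_right ω)

theorem toBilin_apply (ω : V [⋀^Fin 2]→ₗ[ℝ] ℝ) (x y : V) : toBilin ω x y = ω ![x, y] := rfl

theorem toBilin_swap (ω : V [⋀^Fin 2]→ₗ[ℝ] ℝ) (x y : V) : toBilin ω x y = -toBilin ω y x := by
  have h := ω.map_swap ![y, x] (i := 0) (j := 1) (by decide)
  rw [toBilin_apply, toBilin_apply, ← h]
  congr 1
  ext i; fin_cases i <;> simp

theorem stdFrame_isotropic [NeZero n] {ω : V [⋀^Fin 2]→ₗ[ℝ] ℝ} {e f : Fin n → V}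
    (h : IsSymplecticBasis ω e f) (θ : ℝ) (i j : Fin n) :
    toBilin ω (stdFrame e f θ i) (stdFrame e f θ j) = 0 := by
  have ee : ∀ i j, toBilin ω (e i) (e j) = 0 := h.ee
  have ff : ∀ i j, toBilin ω (f i) (f j) = 0 := h.ff
  have ef : ∀ i j, toBilin ω (e i) (f j) = if i = j then 1 else 0 := h.ef
  have fe : ∀ i j, toBilin ω (f i) (e j) = -(if j = i then 1 else 0) := fun i j => by
    rw [toBilin_swap, ef]
  unfold stdFrame
  by_cases hi : i = 0 <;> by_cases hj : j = 0
  · subst hi; subst hj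
    simp [ee, ff, ef, fe]
    ring
  · subst hi
    simp [ee, fe, hj]
  · subst hj
    simp [ee, ef, hi]
  · simp [ee, hi, hj]

theorem stdFrame_linearIndependent [NeZero n] {ω : V [⋀^Fin 2]→ₗ[ℝ] ℝ} {e f : Fin n → V}
    (h : IsSymplecticBasis ω e f) (θ : ℝ) : LinearIndependent ℝ (stdFrame e f θ) := by
  have ee : ∀ i j, toBilin ω (e i) (e j) = 0 := h.ee
  have ff : ∀ i j, toBilin ω (f i) (f j) = 0 := h.ff
  have ef : ∀ i j, toBilin ω (e i) (f j) = if i = j then 1 else 0 := h.ef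
  have fe : ∀ i j, toBilin ω (f i) (e j) = -(if j = i then 1 else 0) := fun i j => by
    rw [toBilin_swap, ef]
  have key : ∀ i j, toBilin ω (stdFrame e f θ i)
      (Function.update f 0 (Real.cos θ • f 0 - Real.sin θ • e 0) j) = if i = j then 1 else 0 := by
    intro i j
    unfold stdFrame
    by_cases hi : i = 0 <;> by_cases hj : j = 0
    · subst hi; subst hj
      simp [ee, ff, ef, fe]
      nlinarith [Real.sin_sq_add_cos_sq θ]
    · subst hi
      simp [ff, ef, hj, Ne.symm hj]
    · subst hj
      simp [ee, ef, hi]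
    · simp [ef, hi, hj]
  rw [Fintype.linearIndependent_iff]
  intro c hc j
  have h1 := congrArg (fun x => toBilin ω x
    (Function.update f 0 (Real.cos θ • f 0 - Real.sin θ • e 0) j)) hc
  simpa [map_sum, LinearMap.sum_apply, key] using h1

/-- The Lagrangian subspace `e^{iθ}ℝ × ℝⁿ⁻¹` in the coordinates given by a symplectic basis. -/
def stdLagrangian [NeZero n] {ω : V [⋀^Fin 2]→ₗ[ℝ] ℝ} {e f : Fin n → V}
    (h : IsSymplecticBasis ω e f) (θ : ℝ) : LGr ω n :=
  ⟨Submodule.span ℝ (Set.range (stdFrame e f θ)), by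
    intro x hx y hy
    rw [← toBilin_apply]
    induction hx using Submodule.span_induction with
    | mem x hx =>
      obtain ⟨i, rfl⟩ := hx
      induction hy using Submodule.span_induction with
      | mem y hy =>
        obtain ⟨j, rfl⟩ := hy
        exact stdFrame_isotropic h θ i j
      | zero => simp
      | add y y' _ _ hy hy' => simp [hy, hy']
      | smul c y _ hy => simp [hy]
    | zero => simp
    | add x x' _ _ hx hx' => simp [hx, hx']
    | smul c x _ hx => simp [hx], by
    rw [finrank_span_eq_card (stdFrame_linearIndependent h θ), Fintype.card_fin]⟩

theorem stdLagrangian_periodic [NeZero n] {ω : V [⋀^Fin 2]→ₗ[ℝ] ℝ} {e f : Fin n → V}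
    (h : IsSymplecticBasis ω e f) : Function.Periodic (stdLagrangian h) Real.pi := by
  have le : ∀ θ : ℝ, Submodule.span ℝ (Set.range (stdFrame e f (θ + Real.pi))) ≤
      Submodule.span ℝ (Set.range (stdFrame e f θ)) := by
    intro θ
    rw [Submodule.span_le]
    rintro _ ⟨i, rfl⟩
    have hmem := Submodule.subset_span (R := ℝ) (Set.mem_range_self (f := stdFrame e f θ) i)
    by_cases hi : i = 0
    · subst hi
      have : stdFrame e f (θ + Real.pi) 0 = -stdFrame e f θ 0 := by
        simp [stdFrame, Real.cos_add_pi, Real.sin_add_pi]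
        abel
      rw [this]
      exact Submodule.neg_mem _ hmem
    · have : stdFrame e f (θ + Real.pi) i = stdFrame e f θ i := by simp [stdFrame, hi]
      rw [this]
      exact hmem
  intro θ
  refine Subtype.ext (le_antisymm (le θ) ?_)
  have h2 : stdFrame e f (θ + Real.pi + Real.pi) = stdFrame e f θ := by
    simp [stdFrame, Real.cos_add_pi, Real.sin_add_pi]
  have h3 := le (θ + Real.pi)
  rw [h2] at h3
  exact h3

/-- The standard loop `ℝ/πℤ → LGr(V)`, `θ ↦ e^{iθ}ℝ × ℝⁿ⁻¹`, in the coordinates given by a symplectic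
basis. It represents the canonical generator of `π₁(LGr(V)) ≅ ℤ`. -/
def stdLoop [NeZero n] {ω : V [⋀^Fin 2]→ₗ[ℝ] ℝ} {e f : Fin n → V}
    (h : IsSymplecticBasis ω e f) : AddCircle Real.pi → LGr ω n :=
  (stdLagrangian_periodic h).lift

/-- The loop `g : ℝ/πℤ → ℝ/πℤ` is positive in `π₁(ℝ/πℤ) ≅ ℤ`: a continuous lift `a : ℝ → ℝ` of it
has positive increment over a period. -/
def IsPositiveLoop (g : AddCircle Real.pi → AddCircle Real.pi) : Prop :=
  ∃ a : ℝ → ℝ, Continuous a ∧ (∀ θ : ℝ, (a θ : AddCircle Real.pi) = g θ) ∧ a 0 < a Real.pi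

/-- The space `𝒰⁺(V)` of those `Ω ∈ 𝒰(V)` whose phase map sends the canonical generator of
`π₁(LGr(V))` to a positive loop. The homotopy class of the standard loop does not depend on the
symplectic basis, since the symplectic group is connected. -/
def UPlus (ω : V [⋀^Fin 2]→ₗ[ℝ] ℝ) (n : ℕ) [NeZero n] : Set (V [⋀^Fin n]→ₗ[ℝ] ℂ) :=
  {Ω | Ω ∈ U ω n ∧ ∀ (e f : Fin n → V) (h : IsSymplecticBasis ω e f),
    IsPositiveLoop (phase Ω ∘ stdLoop h)}

/-- The exterior product `ℓ₁ ∧ … ∧ ℓₙ` of `ℂ`-valued `ℝ`-linear one-forms,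
`(v₁, …, vₙ) ↦ det (ℓ_j (v_i))`. -/
def wedgeOneForms (ℓ : Fin n → V →ₗ[ℝ] ℂ) : V [⋀^Fin n]→ₗ[ℝ] ℂ where
  toFun v := Matrix.det (Matrix.of fun i j => ℓ j (v i))
  map_update_add' := by
    intro inst v i x y
    obtain rfl := Subsingleton.elim inst (instDecidableEqFin n)
    have h : ∀ z, (Matrix.of fun a j => ℓ j (Function.update v i z a)) =
        Matrix.updateRow (Matrix.of fun a j => ℓ j (v a)) i (fun j => ℓ j z) := by
      intro z
      ext a j
      by_cases ha : a = i
      · subst ha; simp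
      · simp [ha]
    rw [h, h, h, ← Matrix.det_updateRow_add]
    congr 2
    ext j
    simp
  map_update_smul' := by
    intro inst v i c x
    obtain rfl := Subsingleton.elim inst (instDecidableEqFin n)
    have h : ∀ z, (Matrix.of fun a j => ℓ j (Function.update v i z a)) =
        Matrix.updateRow (Matrix.of fun a j => ℓ j (v a)) i (fun j => ℓ j z) := by
      intro z
      ext a j
      by_cases ha : a = i
      · subst ha; simp
      · simp [ha]
    rw [h, h, Complex.real_smul, ← Matrix.det_updateRow_smul]
    congr 2
    ext j
    simp
  map_eq_zero_of_eq' v i j hv hij :=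
    Matrix.det_zero_of_row_eq hij (by ext k; simp [hv])

/-- The space `Λ^{k,n-k} V^∨` of forms of type `(k, n-k)` with respect to `J`: the complex span of
exterior products of `n` one-forms of which `k` are complex linear and the others are complex
antilinear. -/
def typeForms (J : V →ₗ[ℝ] V) (n k : ℕ) : Submodule ℂ (V [⋀^Fin n]→ₗ[ℝ] ℂ) :=
  Submodule.span ℂ {Ω | ∃ (ℓ : Fin n → V →ₗ[ℝ] ℂ) (s : Finset (Fin n)), s.card = k ∧
    (∀ i ∈ s, ∀ x, ℓ i (J x) = Complex.I * ℓ i x) ∧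
    (∀ i ∉ s, ∀ x, ℓ i (J x) = -(Complex.I * ℓ i x)) ∧ Ω = wedgeOneForms ℓ}

/-- `c 0, …, c n` are the components of `Ω` of types `(0, n), …, (n, 0)`. -/
def IsTypeDecomposition (J : V →ₗ[ℝ] V) (Ω : V [⋀^Fin n]→ₗ[ℝ] ℂ)
    (c : Fin (n + 1) → V [⋀^Fin n]→ₗ[ℝ] ℂ) : Prop :=
  (∀ k : Fin (n + 1), c k ∈ typeForms J n k) ∧ ∑ k, c k = Ω

/-- The polynomial `p(z) = a_n zⁿ + … + a_0`, `a_k = Ω^{k,n-k}(w)`, where `w = v₁ ∧ … ∧ vₙ`. -/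
def typePolynomial (c : Fin (n + 1) → V [⋀^Fin n]→ₗ[ℝ] ℂ) (v : Fin n → V) : Polynomial ℂ :=
  ∑ k : Fin (n + 1), Polynomial.C (c k v) * Polynomial.X ^ (k : ℕ)

/-- `X` (strongly) deformation retracts to its subspace `A`. -/
def DeformationRetractsTo {E : Type*} [TopologicalSpace E] (X A : Set E) : Prop :=
  A ⊆ X ∧ ∃ H : C(I × X, X), (∀ x : X, H (0, x) = x) ∧ (∀ x : X, (H (1, x) : E) ∈ A) ∧
    ∀ (t : I) (x : X), (x : E) ∈ A → H (t, x) = x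

end

end LagForms

open scoped ComplexConjugate

namespace LagForms

noncomputable section

/-! Fix a unitary frame `e` of a Lagrangian subspace. Rotating its vectors independently by phases
again gives Lagrangian frames. Extend `Ω` complex multilinearly to a form `M` in pairs `(u_j, v_j)`,
the coordinates along the types (1,0) and (0,1) of the complexified line of `e j`. Up to scaling in
each pair, the torus `|u_j| = |v_j| ≠ 0` consists of the rotated frames, so `M` has no zeros there.

Along a standard loop `Ω` runs through `A cos θ + B sin θ`, an ellipse around 0, and the loop of
phases is positive exactly when `Im (conj A * B) > 0`. For a unitary frame this says that `M`, as a
linear form `u_j α + v_j β` in one pair, has `|β| < |α|`. Freeing the variables one at a time from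
the torus, as in Lee-Yang arguments, gives `M ≠ 0` on the polydisc `|v_j| ≤ |u_j| ≠ 0`
(`multilinear_ne_zero_of_torus`).

On the diagonal `(1, w)`, `M` equals `∑ w^(n-k) Ω^{k,n-k}(e)` (`frameForm_eq_sum`), so this sum has
no zeros with `|w| ≤ 1`. With `w = 1/z` this is the claim on the roots. With `w = s` in `[0, 1]` it
shows that scaling `Ω^{k,n-k}` by `s^(n-k)` stays in `𝒰(V)`, hence by continuity in `𝒰⁺(V)`; letting
`s` go to 0 retracts onto the `(n, 0)`-forms. These form a complex line, and the line without its
origin is a circle up to homotopy. -/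

/-- A continuous real function on `[0, 1]` without zeros keeps its sign. -/
theorem pos_of_continuous_of_ne_zero {g : ℝ → ℝ} (hg : Continuous g)
    (h : ∀ s ∈ Set.Icc (0 : ℝ) 1, g s ≠ 0) (h0 : 0 < g 0) {s : ℝ} (hs : s ∈ Set.Icc (0 : ℝ) 1) :
    0 < g s := by
  by_contra hneg
  obtain ⟨t, ht, hgt⟩ := intermediate_value_Icc' hs.1 hg.continuousOn ⟨not_lt.1 hneg, h0.le⟩
  exact h t ⟨ht.1, ht.2.trans hs.2⟩ hgt

/-! ### Zeros of multilinear forms in pairs of variables -/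

section Stability

variable {ι : Type*} [DecidableEq ι]

theorem multilinear_update_pair (M : MultilinearMap ℂ (fun _ : ι => ℂ × ℂ) ℂ) (x : ι → ℂ × ℂ)
    (j : ι) (u v : ℂ) : M (Function.update x j (u, v)) =
      u * M (Function.update x j (1, 0)) + v * M (Function.update x j (0, 1)) := by
  have : ((u, v) : ℂ × ℂ) = u • ((1, 0) : ℂ × ℂ) + v • ((0, 1) : ℂ × ℂ) := by simp
  rw [this, M.map_update_add, M.map_update_smul, M.map_update_smul, smul_eq_mul, smul_eq_mul]

/-- If `u α + v β ≠ 0` whenever `|u| = |v| ≠ 0`, then `|α| ≠ |β|`. -/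
theorem norm_ne_of_linear_ne_zero {α β : ℂ}
    (h : ∀ u v : ℂ, ‖v‖ = ‖u‖ → u ≠ 0 → u * α + v * β ≠ 0) : ‖α‖ ≠ ‖β‖ := by
  intro hαβ
  by_cases hβ : β = 0
  · have hα : α = 0 := by simpa [hβ] using hαβ
    exact h 1 1 rfl one_ne_zero (by simp [hα, hβ])
  · exact h β (-α) (by simpa using hαβ) hβ (by ring)

/-- Suppose that a form in pairs of variables `(u_j, v_j)` that is linear in each pair has no
zeros with `|u_j| = |v_j| ≠ 0` and that there, as a function of each single pair, it has its zero in
`|u_j| < |v_j|`. Then it has no zeros with `|v_j| ≤ |u_j| ≠ 0`. -/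
theorem multilinear_ne_zero_of_torus [Fintype ι] (M : MultilinearMap ℂ (fun _ : ι => ℂ × ℂ) ℂ)
    (hM : Continuous M)
    (h0 : ∀ x : ι → ℂ × ℂ, (∀ i, ‖(x i).2‖ = ‖(x i).1‖ ∧ (x i).1 ≠ 0) → M x ≠ 0)
    (h1 : ∀ (x : ι → ℂ × ℂ) (j : ι), (∀ i, ‖(x i).2‖ = ‖(x i).1‖ ∧ (x i).1 ≠ 0) →
      ‖M (Function.update x j (0, 1))‖ < ‖M (Function.update x j (1, 0))‖)
    (x : ι → ℂ × ℂ) (hx : ∀ i, ‖(x i).2‖ ≤ ‖(x i).1‖ ∧ (x i).1 ≠ 0) : M x ≠ 0 := by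
  -- `S` is the set of indices already freed from the torus. The strict inequality in the remaining
  -- variables is carried along, since it is what frees the next one.
  have key : ∀ S : Finset ι, ∀ x : ι → ℂ × ℂ, (∀ i, ‖(x i).2‖ ≤ ‖(x i).1‖ ∧ (x i).1 ≠ 0) →
      (∀ i ∉ S, ‖(x i).2‖ = ‖(x i).1‖) →
      M x ≠ 0 ∧ ∀ j ∉ S, ‖M (Function.update x j (0, 1))‖ < ‖M (Function.update x j (1, 0))‖ := by
    intro S
    induction S using Finset.induction_on with
    | empty =>
      intro x hx hxS
      have hx' : ∀ i, ‖(x i).2‖ = ‖(x i).1‖ ∧ (x i).1 ≠ 0 := fun i => ⟨hxS i (by simp), (hx i).2⟩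
      exact ⟨h0 x hx', fun j _ => h1 x j hx'⟩
    | insert a S ha ih =>
      -- The pair at `a` is replaced by `(1, 1)` only to meet the hypotheses of `ih`; the
      -- coefficients of the linear form in that pair do not see it. A zero would give `|u| |α| =
      -- |v| |β|`, impossible for `|β| < |α|` and `|v| ≤ |u| ≠ 0`.
      have nz : ∀ x : ι → ℂ × ℂ, (∀ i, ‖(x i).2‖ ≤ ‖(x i).1‖ ∧ (x i).1 ≠ 0) →
          (∀ i ∉ insert a S, ‖(x i).2‖ = ‖(x i).1‖) → M x ≠ 0 := by
        intro x hx hxS hMx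
        obtain ⟨-, hlt⟩ := ih (Function.update x a (1, 1)) (by
            intro i
            by_cases hi : i = a
            · subst hi; simp
            · simpa [hi] using hx i) (by
            intro i hi
            by_cases hia : i = a
            · subst hia; simp
            · simpa [hia] using hxS i (by simp [hia, hi]))
        have hlt := hlt a ha
        rw [Function.update_idem, Function.update_idem] at hlt
        have e := multilinear_update_pair M x a (x a).1 (x a).2
        rw [Prod.mk.eta, Function.update_eq_self, hMx] at e
        have e2 : ‖(x a).1‖ * ‖M (Function.update x a (1, 0))‖ =
            ‖(x a).2‖ * ‖M (Function.update x a (0, 1))‖ := by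
          rw [← norm_mul, ← norm_mul, eq_neg_of_add_eq_zero_left e.symm, norm_neg]
        have hpos : 0 < ‖(x a).1‖ := norm_pos_iff.2 (hx a).2
        have := mul_lt_mul_of_pos_left hlt hpos
        have := mul_le_mul_of_nonneg_right (hx a).1 (norm_nonneg (M (Function.update x a (0, 1))))
        linarith
      intro x hx hxS
      refine ⟨nz x hx hxS, fun j hj => ?_⟩
      -- A path from a point of the torus to `x` that moves only the freed variables. By `nz` the
      -- linear form in the pair `j` has no zeros with `|u| = |v| ≠ 0` along it, so `|α| - |β|`
      -- keeps the sign that it has on the torus.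
      set y : ℝ → ι → ℂ × ℂ := fun s i =>
        ((x i).1, (1 - (s : ℂ)) * (if i ∈ insert a S then (x i).1 else (x i).2) + s * (x i).2) with hy
      have hy1 : y 1 = x := by ext i <;> simp [hy]
      have hyc : Continuous y := by fun_prop
      have hyx : ∀ s ∈ Set.Icc (0 : ℝ) 1, (∀ i, ‖(y s i).2‖ ≤ ‖(y s i).1‖ ∧ (y s i).1 ≠ 0) := by
        intro s hs i
        refine ⟨?_, (hx i).2⟩
        have hw : ‖(if i ∈ insert a S then (x i).1 else (x i).2)‖ ≤ ‖(x i).1‖ := by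
          split_ifs
          · rfl
          · exact (hx i).1
        have hs1 : ‖(1 - (s : ℂ))‖ = 1 - s := by
          rw [← Complex.ofReal_one, ← Complex.ofReal_sub, Complex.norm_real,
            Real.norm_of_nonneg (by linarith [hs.2])]
        have hs0 : ‖(s : ℂ)‖ = s := by rw [Complex.norm_real, Real.norm_of_nonneg hs.1]
        calc ‖(y s i).2‖ ≤ (1 - s) * ‖(if i ∈ insert a S then (x i).1 else (x i).2)‖ +
              s * ‖(x i).2‖ := by
              refine (norm_add_le _ _).trans ?_
              rw [norm_mul, norm_mul, hs1, hs0]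
          _ ≤ (1 - s) * ‖(x i).1‖ + s * ‖(x i).1‖ := by
              gcongr
              · linarith [hs.2]
              · exact hs.1
              · exact (hx i).1
          _ = ‖(y s i).1‖ := by ring
      have hyS : ∀ s, ∀ i ∉ insert a S, y s i = x i := by
        intro s i hi
        ext
        · rfl
        · simp only [hy, if_neg hi]; ring
      have hpos := pos_of_continuous_of_ne_zero (g := fun s =>
          ‖M (Function.update (y s) j (1, 0))‖ - ‖M (Function.update (y s) j (0, 1))‖)
          (by
            have hu : ∀ p : ℂ × ℂ, Continuous fun s => M (Function.update (y s) j p) := fun p =>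
              hM.comp (hyc.update j continuous_const)
            exact (hu _).norm.sub (hu _).norm) (by
            intro s hs
            refine sub_ne_zero.2 (norm_ne_of_linear_ne_zero fun u v huv hu => ?_)
            rw [← multilinear_update_pair]
            refine nz _ (fun i => ?_) (fun i hi => ?_)
            · by_cases hij : i = j
              · subst hij; simp [huv, hu]
              · simpa [hij] using hyx s hs i
            · by_cases hij : i = j
              · subst hij; simp [huv]
              · rw [Function.update_of_ne hij, hyS s i hi, hxS i hi]) (by
            refine sub_pos.2 (h1 _ j fun i => ⟨?_, (hx i).2⟩)
            by_cases hi : i ∈ insert a S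
            · simp only [hy, if_pos hi]; simp
            · rw [hyS 0 i hi, hxS i hi]) (s := 1) (by simp)
      rw [hy1] at hpos
      exact sub_pos.1 hpos
  exact (key Finset.univ x hx (by simp)).1

end Stability

variable {V : Type*} [AddCommGroup V] [Module ℝ V] {n : ℕ}

/-! ### Symplectic bases and unitary frames -/

namespace IsSymplecticBasis

variable {ω : V [⋀^Fin 2]→ₗ[ℝ] ℝ} {e f : Fin n → V}

theorem bilin_ee (h : IsSymplecticBasis ω e f) (i j : Fin n) : toBilin ω (e i) (e j) = 0 :=
  h.ee i j

theorem bilin_ff (h : IsSymplecticBasis ω e f) (i j : Fin n) : toBilin ω (f i) (f j) = 0 :=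
  h.ff i j

theorem bilin_ef (h : IsSymplecticBasis ω e f) (i j : Fin n) :
    toBilin ω (e i) (f j) = if i = j then 1 else 0 :=
  h.ef i j

theorem bilin_fe (h : IsSymplecticBasis ω e f) (i j : Fin n) :
    toBilin ω (f i) (e j) = if i = j then -1 else 0 := by
  rw [toBilin_swap, h.bilin_ef]
  by_cases hij : i = j
  · simp [hij]
  · simp [hij, Ne.symm hij]

theorem linearIndependent (h : IsSymplecticBasis ω e f) :
    LinearIndependent ℝ (Sum.elim e f) := by
  rw [Fintype.linearIndependent_iff]
  intro c hc
  have key : ∀ y, ∑ i, c (Sum.inl i) * toBilin ω (e i) y +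
      ∑ i, c (Sum.inr i) * toBilin ω (f i) y = 0 := by
    intro y
    have := congrArg (fun x => toBilin ω x y) hc
    simpa [Fintype.sum_sum_type, LinearMap.sum_apply] using this
  rintro (j | j)
  · simpa [h.bilin_ef, h.bilin_ff] using key (f j)
  · simpa [h.bilin_ee, h.bilin_fe] using key (e j)

theorem reindex (h : IsSymplecticBasis ω e f) (τ : Equiv.Perm (Fin n)) :
    IsSymplecticBasis ω (e ∘ τ) (f ∘ τ) where
  ee i j := h.ee _ _
  ff i j := h.ff _ _
  ef i j := by simp [h.ef]

/-- The basis of `V` given by a symplectic basis. -/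
def basis [NeZero n] (h : IsSymplecticBasis ω e f) (hV : Module.finrank ℝ V = 2 * n) :
    Module.Basis (Fin n ⊕ Fin n) ℝ V :=
  basisOfLinearIndependentOfCardEqFinrank h.linearIndependent (by simp [hV, two_mul])

theorem coe_basis [NeZero n] (h : IsSymplecticBasis ω e f)
    (hV : Module.finrank ℝ V = 2 * n) : ⇑(h.basis hV) = Sum.elim e f := by
  simp [basis]

end IsSymplecticBasis

section Compatible

variable {ω : V [⋀^Fin 2]→ₗ[ℝ] ℝ} {J : V →ₗ[ℝ] V}

theorem IsCompatible.bilin_invariant (hJ : IsCompatible ω J) (x y : V) :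
    toBilin ω (J x) (J y) = toBilin ω x y :=
  hJ.invariant x y

theorem IsCompatible.bilin_apply_left (hJ : IsCompatible ω J) (x y : V) :
    toBilin ω (J x) y = -toBilin ω x (J y) := by
  rw [← hJ.bilin_invariant x, hJ.sq_eq_neg]
  simp

theorem IsCompatible.bilin_symm (hJ : IsCompatible ω J) (x y : V) :
    toBilin ω x (J y) = toBilin ω y (J x) := by
  rw [toBilin_swap, hJ.bilin_apply_left, neg_neg]

/-- The complex scalar `e^{iθ}` on the complex vector space `(V, J)`. -/
def rotation (J : V →ₗ[ℝ] V) (θ : ℝ) : V →ₗ[ℝ] V :=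
  Real.cos θ • LinearMap.id + Real.sin θ • J

theorem rotation_apply (J : V →ₗ[ℝ] V) (θ : ℝ) (x : V) :
    rotation J θ x = Real.cos θ • x + Real.sin θ • J x := rfl

theorem IsCompatible.bilin_rotation (hJ : IsCompatible ω J) (θ : ℝ) (x y : V) :
    toBilin ω (rotation J θ x) (rotation J θ y) = toBilin ω x y := by
  have h := Real.sin_sq_add_cos_sq θ
  simp only [rotation_apply, map_add, map_smul, LinearMap.add_apply, LinearMap.smul_apply,
    smul_eq_mul, hJ.bilin_invariant, hJ.bilin_apply_left]
  linear_combination toBilin ω x y * h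

theorem J_rotation (hJ : IsCompatible ω J) (θ : ℝ) (x : V) :
    J (rotation J θ x) = rotation J (θ + Real.pi / 2) x := by
  simp [rotation_apply, Real.cos_add_pi_div_two, Real.sin_add_pi_div_two, hJ.sq_eq_neg, add_comm]

/-- Independent rotations of the vectors of a unitary frame give a unitary frame. -/
theorem IsSymplecticBasis.rotate {e : Fin n → V} (hJ : IsCompatible ω J)
    (h : IsSymplecticBasis ω e (fun i => J (e i))) (θ : Fin n → ℝ) :
    IsSymplecticBasis ω (fun i => rotation J (θ i) (e i))
      (fun i => J (rotation J (θ i) (e i))) := by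
  have ee := h.bilin_ee
  have ef := h.bilin_ef
  have iso : ∀ i j, toBilin ω (rotation J (θ i) (e i)) (rotation J (θ j) (e j)) = 0 := by
    intro i j
    by_cases hij : i = j
    · subst hij
      rw [hJ.bilin_rotation, ee]
    · simp [rotation_apply, ee, ef, hJ.bilin_apply_left, hij, hJ.sq_eq_neg]
  refine ⟨iso, fun i j => (hJ.invariant _ _).trans (iso i j), fun i j => ?_⟩
  rw [← toBilin_apply]
  by_cases hij : i = j
  · subst hij
    have : J (rotation J (θ i) (e i)) = rotation J (θ i) (J (e i)) := by
      simp [rotation_apply]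
    rw [this, hJ.bilin_rotation, ef]
  · simp [rotation_apply, ee, ef, hJ.bilin_apply_left, hij, hJ.sq_eq_neg]

/-- Fewer linear conditions than the dimension of `W` leave a unit vector in `W`. -/
theorem IsCompatible.exists_unit_mem (hJ : IsCompatible ω J) (W : Submodule ℝ V)
    [FiniteDimensional ℝ W] {ι : Type*} [Fintype ι] (φ : ι → V →ₗ[ℝ] ℝ)
    (hφ : Fintype.card ι < Module.finrank ℝ W) :
    ∃ x ∈ W, toBilin ω x (J x) = 1 ∧ ∀ i, φ i x = 0 := by
  have hker : (LinearMap.pi fun i => (φ i).comp W.subtype).ker ≠ ⊥ :=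
    LinearMap.ker_ne_bot_of_finrank_lt (by simpa using hφ)
  obtain ⟨x, hx, hx0⟩ := Submodule.exists_mem_ne_zero_of_ne_bot hker
  have hpos : 0 < toBilin ω (x : V) (J x) := hJ.pos x (by simpa using hx0)
  have hφx : ∀ i, φ i x = 0 := fun i => congrFun (LinearMap.mem_ker.1 hx) i
  refine ⟨(Real.sqrt (toBilin ω (x : V) (J x)))⁻¹ • (x : V), W.smul_mem _ x.2, ?_,
    fun i => by simp [hφx i]⟩
  simp only [map_smul, LinearMap.smul_apply, smul_eq_mul, ← mul_assoc, ← mul_inv]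
  rw [Real.mul_self_sqrt hpos.le, inv_mul_cancel₀ hpos.ne']

theorem IsSymplecticBasis.snoc {k : ℕ} {e : Fin k → V} (hJ : IsCompatible ω J)
    (h : IsSymplecticBasis ω e (fun i => J (e i))) {x : V} (hx : toBilin ω x (J x) = 1)
    (hex : ∀ i, toBilin ω (e i) x = 0) (heJx : ∀ i, toBilin ω (e i) (J x) = 0) :
    IsSymplecticBasis ω (Fin.snoc e x : Fin (k + 1) → V)
      (fun i => J ((Fin.snoc e x : Fin (k + 1) → V) i)) := by
  have hxx : toBilin ω x x = 0 := by have := toBilin_swap ω x x; linarith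
  have hxe : ∀ i, toBilin ω x (e i) = 0 := fun i => by rw [toBilin_swap, hex, neg_zero]
  have hxJe : ∀ i, toBilin ω x (J (e i)) = 0 := fun i => by rw [hJ.bilin_symm, heJx]
  have iso : ∀ i j, toBilin ω ((Fin.snoc e x : Fin (k + 1) → V) i)
      ((Fin.snoc e x : Fin (k + 1) → V) j) = 0 := by
    intro i j
    refine Fin.lastCases ?_ (fun i => ?_) i <;> refine Fin.lastCases ?_ (fun j => ?_) j <;>
      simp [hxx, hxe, hex, h.bilin_ee]
  refine ⟨iso, fun i j => (hJ.invariant _ _).trans (iso i j), fun i j => ?_⟩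
  rw [← toBilin_apply]
  refine Fin.lastCases ?_ (fun i => ?_) i <;> refine Fin.lastCases ?_ (fun j => ?_) j
  · simp [hx]
  · simp [hxJe, (Fin.castSucc_lt_last j).ne']
  · simp [heJx, (Fin.castSucc_lt_last i).ne]
  · simp [h.bilin_ef]

/-- Gram-Schmidt: the next vector has to satisfy `2 k` real linear conditions, fewer than the
dimension. -/
theorem IsCompatible.exists_unitary_frame (hJ : IsCompatible ω J) [FiniteDimensional ℝ V]
    (k : ℕ) (hk : 2 * k ≤ Module.finrank ℝ V) :
    ∃ e : Fin k → V, IsSymplecticBasis ω e (fun i => J (e i)) := by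
  induction k with
  | zero => exact ⟨Fin.elim0, fun i => i.elim0, fun i => i.elim0, fun i => i.elim0⟩
  | succ k ih =>
    obtain ⟨e, he⟩ := ih (by omega)
    obtain ⟨x, -, hx, hφ⟩ := hJ.exists_unit_mem (⊤ : Submodule ℝ V)
      (Sum.elim (fun i => toBilin ω (e i)) (fun i => (toBilin ω (e i)).comp J))
      (by rw [finrank_top]; simp; omega)
    exact ⟨_, he.snoc hJ hx (fun i => hφ (Sum.inl i)) (fun i => hφ (Sum.inr i))⟩

/-- Inside an isotropic subspace the conditions `ω(e_i, x) = 0` are automatic. Only `k` conditions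
remain, so the frame can fill the subspace. -/
theorem IsCompatible.exists_unitary_frame_mem (hJ : IsCompatible ω J) (L : Submodule ℝ V)
    [FiniteDimensional ℝ L] (hL : ∀ x ∈ L, ∀ y ∈ L, ω ![x, y] = 0)
    (k : ℕ) (hk : k ≤ Module.finrank ℝ L) :
    ∃ e : Fin k → V, (∀ i, e i ∈ L) ∧ IsSymplecticBasis ω e (fun i => J (e i)) := by
  induction k with
  | zero =>
    exact ⟨Fin.elim0, fun i => i.elim0, fun i => i.elim0, fun i => i.elim0, fun i => i.elim0⟩
  | succ k ih =>
    obtain ⟨e, heL, he⟩ := ih (by omega)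
    obtain ⟨x, hxL, hx, hφ⟩ := hJ.exists_unit_mem L (fun i => (toBilin ω (e i)).comp J)
      (by simp; omega)
    refine ⟨Fin.snoc e x, fun i => ?_, he.snoc hJ hx (fun i => hL _ (heL i) _ hxL) hφ⟩
    refine Fin.lastCases ?_ (fun i => ?_) i <;> simp [hxL, heL]

end Compatible

/-! ### The exterior product with `ω` -/

/-- A sum over shuffles with chosen representatives, so that linearity, pullback and vanishing can
be checked term by term. -/
theorem wedge_apply (ω : V [⋀^Fin 2]→ₗ[ℝ] ℝ) (Ω : V [⋀^Fin n]→ₗ[ℝ] ℂ) (v : Fin 2 ⊕ Fin n → V) :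
    wedge ω Ω v = ∑ q : Equiv.Perm.ModSumCongr (Fin 2) (Fin n),
      Equiv.Perm.sign q.out •
        (ω fun i => v (q.out (Sum.inl i))) • Ω fun i => v (q.out (Sum.inr i)) := by
  have h : ∀ q : Equiv.Perm.ModSumCongr (Fin 2) (Fin n),
      AlternatingMap.domCoprod.summand ω Ω q v = Equiv.Perm.sign q.out •
        TensorProduct.tmul ℝ (ω fun i => v (q.out (Sum.inl i)))
          (Ω fun i => v (q.out (Sum.inr i))) := by
    intro q
    conv_lhs => rw [← Quotient.out_eq' q]
    rw [AlternatingMap.domCoprod.summand_mk'']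
    simp [MultilinearMap.domCoprod_apply]
  simp only [wedge, LinearMap.compAlternatingMap_apply, AlternatingMap.domCoprod_apply,
    sum_apply, h, map_sum, LinearEquiv.coe_coe]
  refine Finset.sum_congr rfl fun q _ => ?_
  rcases Int.units_eq_one_or (Equiv.Perm.sign q.out) with h | h <;> simp [h]

/-- The linear map `Ω ↦ ω ∧ Ω`. -/
def wedgeLeft (ω : V [⋀^Fin 2]→ₗ[ℝ] ℝ) :
    (V [⋀^Fin n]→ₗ[ℝ] ℂ) →ₗ[ℂ] V [⋀^Fin 2 ⊕ Fin n]→ₗ[ℝ] ℂ where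
  toFun := wedge ω
  map_add' Ω Ω' := by
    ext v
    simp [wedge_apply, Finset.sum_add_distrib]
  map_smul' c Ω := by
    ext v
    simp only [wedge_apply, AlternatingMap.smul_apply, RingHom.id_apply, Finset.smul_sum]
    refine Finset.sum_congr rfl fun q _ => ?_
    rw [smul_comm c, smul_comm c]

theorem wedge_compLinearMap (ω : V [⋀^Fin 2]→ₗ[ℝ] ℝ) (Ω : V [⋀^Fin n]→ₗ[ℝ] ℂ) (R : V →ₗ[ℝ] V) :
    wedge (ω.compLinearMap R) (Ω.compLinearMap R) = (wedge ω Ω).compLinearMap R := by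
  ext v
  simp [wedge_apply]

theorem IsPrimitive.comp_rotation {ω : V [⋀^Fin 2]→ₗ[ℝ] ℝ} {J : V →ₗ[ℝ] V}
    (hJ : IsCompatible ω J) {Ω : V [⋀^Fin n]→ₗ[ℝ] ℂ} (hΩ : IsPrimitive ω Ω) (θ : ℝ) :
    IsPrimitive ω (Ω.compLinearMap (rotation J θ)) := by
  have hω : ω.compLinearMap (rotation J θ) = ω := by
    ext v
    have hv : ∀ w : Fin 2 → V, ω w = toBilin ω (w 0) (w 1) := fun w => by
      rw [toBilin_apply]; congr 1; ext i; fin_cases i <;> rfl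
    rw [AlternatingMap.compLinearMap_apply, hv, hv]
    exact hJ.bilin_rotation θ _ _
  unfold IsPrimitive at *
  rw [← hω, wedge_compLinearMap, hΩ]
  ext; simp

/-! ### Values on frames of Lagrangian subspaces -/

theorem LGr.finiteDimensional [NeZero n] {ω : V [⋀^Fin 2]→ₗ[ℝ] ℝ} (L : LGr ω n) :
    FiniteDimensional ℝ L.1 :=
  FiniteDimensional.of_finrank_pos (by rw [L.2.2]; exact Nat.pos_of_ne_zero (NeZero.ne n))

/-- `n` vectors spanning an `n`-dimensional subspace form a basis of it. -/
theorem LGr.exists_basis [NeZero n] {ω : V [⋀^Fin 2]→ₗ[ℝ] ℝ} (L : LGr ω n) {v : Fin n → V}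
    (hv : Submodule.span ℝ (Set.range v) = L.1) :
    ∃ b : Module.Basis (Fin n) ℝ L.1, ∀ i, (b i : V) = v i := by
  have := L.finiteDimensional
  have hmem : ∀ i, v i ∈ L.1 := fun i => hv ▸ Submodule.subset_span (Set.mem_range_self i)
  have hli : LinearIndependent ℝ v := by
    rw [linearIndependent_iff_card_eq_finrank_span, Set.finrank, hv, L.2.2, Fintype.card_fin]
  have hli' : LinearIndependent ℝ (fun i => (⟨v i, hmem i⟩ : L.1)) :=
    LinearIndependent.of_comp L.1.subtype hli
  refine ⟨basisOfLinearIndependentOfCardEqFinrank hli' (by simp [L.2.2]), fun i => ?_⟩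
  simp

/-- A form of top degree is a multiple of the determinant. -/
theorem topForm_apply_eq_det_smul {M : Type*} [AddCommGroup M] [Module ℝ M]
    (b : Module.Basis (Fin n) ℝ M) (Ω : M [⋀^Fin n]→ₗ[ℝ] ℂ) (v : Fin n → M) :
    Ω v = b.det v • Ω b := by
  have hΩ : Ω = (LinearMap.toSpanSingleton ℝ ℂ (Ω b)).compAlternatingMap b.det := by
    refine b.ext_alternating fun f hf => ?_
    obtain ⟨τ, rfl⟩ : ∃ τ : Equiv.Perm (Fin n), ⇑τ = f :=
      ⟨Equiv.ofBijective f (Finite.injective_iff_bijective.1 hf), rfl⟩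
    have e : (fun i => b (τ i)) = ⇑b ∘ τ := rfl
    simp only [LinearMap.compAlternatingMap_apply, e, AlternatingMap.map_perm, b.det_self,
      LinearMap.toSpanSingleton_apply]
    rcases Int.units_eq_one_or (Equiv.Perm.sign τ) with h | h <;> simp [h]
  exact congrArg (fun A : M [⋀^Fin n]→ₗ[ℝ] ℂ => A v) hΩ

/-- The values of all `n`-forms on two frames of a Lagrangian subspace are proportional. -/
theorem LGr.exists_ratio [NeZero n] {ω : V [⋀^Fin 2]→ₗ[ℝ] ℝ} (L : LGr ω n) {v w : Fin n → V}
    (hv : Submodule.span ℝ (Set.range v) = L.1) (hw : Submodule.span ℝ (Set.range w) = L.1) :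
    ∃ r : ℝ, r ≠ 0 ∧ ∀ Ω : V [⋀^Fin n]→ₗ[ℝ] ℂ, Ω w = r • Ω v := by
  obtain ⟨b, hb⟩ := L.exists_basis hv
  obtain ⟨b', hb'⟩ := L.exists_basis hw
  refine ⟨b.det b', (b.isUnit_det b').ne_zero, fun Ω => ?_⟩
  have := topForm_apply_eq_det_smul b (Ω.compLinearMap L.1.subtype) b'
  simpa [Function.comp_def, hb, hb'] using this

theorem LGr.restrict_ne_zero_iff [NeZero n] {ω : V [⋀^Fin 2]→ₗ[ℝ] ℝ} (L : LGr ω n) {v : Fin n → V}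
    (hv : Submodule.span ℝ (Set.range v) = L.1) (Ω : V [⋀^Fin n]→ₗ[ℝ] ℂ) :
    Ω.compLinearMap L.1.subtype ≠ 0 ↔ Ω v ≠ 0 := by
  obtain ⟨b, hb⟩ := L.exists_basis hv
  have hbv : Ω.compLinearMap L.1.subtype b = Ω v := by simp [hb]
  refine ⟨fun h h0 => h ?_, fun h h0 => h (by rw [← hbv, h0]; rfl)⟩
  ext w
  rw [topForm_apply_eq_det_smul b (Ω.compLinearMap L.1.subtype) w, hbv, h0]
  simp

theorem LGr.span_basis [NeZero n] {ω : V [⋀^Fin 2]→ₗ[ℝ] ℝ} (L : LGr ω n) :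
    Submodule.span ℝ (Set.range fun i => (L.basis i : V)) = L.1 := by
  have : (Set.range fun i => (L.basis i : V)) = L.1.subtype '' Set.range L.basis := by
    rw [← Set.range_comp]; rfl
  rw [this, Submodule.span_image, L.basis.span_eq, Submodule.map_subtype_top]

/-- A negative factor changes the argument by an odd multiple of `π`, which is lost modulo `π`.
Hence the phase does not depend on the frame of `L`. -/
theorem arg_smul_coe_addCircle {r : ℝ} (hr : r ≠ 0) {z : ℂ} (hz : z ≠ 0) :
    (((r • z).arg : ℝ) : AddCircle Real.pi) = (z.arg : ℝ) := by
  rcases lt_or_gt_of_ne hr with h | h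
  · have e : r • z = ((-r : ℝ) : ℂ) * (-z) := by simp
    rw [e, Complex.arg_real_mul _ (by linarith)]
    have h2 := Complex.arg_neg_coe_angle hz
    rw [← Real.Angle.coe_add, Real.Angle.angle_eq_iff_two_pi_dvd_sub] at h2
    obtain ⟨k, hk⟩ := h2
    have h3 : (-z).arg = z.arg + (2 * k + 1 : ℤ) • Real.pi := by
      rw [zsmul_eq_mul]; push_cast; linarith
    rw [h3, AddCircle.coe_add, AddCircle.coe_zsmul, AddCircle.coe_period, smul_zero, add_zero]
  · rw [Complex.real_smul, Complex.arg_real_mul _ h]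

theorem phase_eq [NeZero n] {ω : V [⋀^Fin 2]→ₗ[ℝ] ℝ} (L : LGr ω n) {v : Fin n → V}
    (hv : Submodule.span ℝ (Set.range v) = L.1) {Ω : V [⋀^Fin n]→ₗ[ℝ] ℂ} (hΩ : Ω v ≠ 0) :
    phase Ω L = ((Ω v).arg : ℝ) := by
  obtain ⟨r, hr, h⟩ := L.exists_ratio hv L.span_basis
  rw [phase, h Ω, arg_smul_coe_addCircle hr hΩ]

/-! ### Phases of `A cos θ + B sin θ` -/

/-- Otherwise `A` and `B` are real-proportional, and the segment that replaces the ellipse passes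
through 0. -/
theorem im_conj_mul_ne_zero {A B : ℂ} (h : ∀ θ : ℝ, Real.cos θ • A + Real.sin θ • B ≠ 0) :
    (conj A * B).im ≠ 0 := by
  intro h0
  have hA : A ≠ 0 := by simpa using h 0
  have hr : B = ((conj A * B).re / Complex.normSq A : ℝ) • A := by
    have h1 : conj A * B = ((conj A * B).re : ℂ) := Complex.ext (by simp) (by simpa using h0)
    have hn : (Complex.normSq A : ℂ) ≠ 0 := by simpa using hA
    rw [Complex.real_smul, Complex.ofReal_div, ← h1, div_mul_eq_mul_div, eq_div_iff hn,
      ← Complex.mul_conj]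
    ring
  set r := (conj A * B).re / Complex.normSq A
  have hs : 0 < Real.sqrt (1 + r ^ 2) := Real.sqrt_pos.2 (by positivity)
  -- If `B = r A`, this angle solves `cos θ + r sin θ = 0`.
  have := h (Real.arctan r + Real.pi / 2)
  rw [Real.cos_add_pi_div_two, Real.sin_add_pi_div_two, Real.sin_arctan, Real.cos_arctan, hr,
    smul_smul, ← add_smul] at this
  apply this
  rw [show -(r / Real.sqrt (1 + r ^ 2)) + 1 / Real.sqrt (1 + r ^ 2) * r = 0 by ring, zero_smul]

/-- A continuous lift of the argument of `A cos θ + B sin θ`. -/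
theorem exists_arg_lift {A B : ℂ} (h : ∀ θ : ℝ, Real.cos θ • A + Real.sin θ • B ≠ 0) :
    ∃ a : ℝ → ℝ, Continuous a ∧
      (∀ θ : ℝ, (a θ : AddCircle Real.pi) = ((Real.cos θ • A + Real.sin θ • B).arg : ℝ)) ∧
      (0 < (conj A * B).im → a 0 < a Real.pi) ∧ ((conj A * B).im < 0 → a Real.pi < a 0) := by
  set F : ℝ → ℂ := fun θ => Real.cos θ • A + Real.sin θ • B with hF
  set F' : ℝ → ℂ := fun θ => -Real.sin θ • A + Real.cos θ • B with hF'
  have hFd : ∀ θ, HasDerivAt F (F' θ) θ := fun θ =>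
    ((Real.hasDerivAt_cos θ).smul_const A).add ((Real.hasDerivAt_sin θ).smul_const B)
  have hFc : Continuous F := by fun_prop
  have hF'c : Continuous F' := by fun_prop
  have hqc : Continuous fun θ => F' θ / F θ := hF'c.div hFc h
  -- A primitive of the logarithmic derivative, so that `F = A exp G` and `Im G` measures the change
  -- of argument.
  set G : ℝ → ℂ := fun θ => ∫ t in (0 : ℝ)..θ, F' t / F t with hG
  have hGd : ∀ θ, HasDerivAt G (F' θ / F θ) θ := fun θ =>
    intervalIntegral.integral_hasDerivAt_right (hqc.intervalIntegrable _ _)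
      (hqc.stronglyMeasurableAtFilter _ _) hqc.continuousAt
  have hE : ∀ θ, F θ * Complex.exp (-G θ) = A := by
    intro θ
    have hd : ∀ θ, HasDerivAt (fun θ => F θ * Complex.exp (-G θ)) 0 θ := by
      intro θ
      have := (hFd θ).mul ((hGd θ).neg.cexp)
      refine this.congr_deriv ?_
      have hFθ : F θ ≠ 0 := h θ
      field_simp
      ring
    have := is_const_of_deriv_eq_zero (fun θ => (hd θ).differentiableAt) (fun θ => (hd θ).deriv) θ 0
    simpa [hF, hG] using this
  -- Since `F` and `F'` are a rotation of the pair `(A, B)`, the quantity `Im (conj F * F')` is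
  -- constant. So the argument is strictly monotone as soon as this constant is nonzero.
  have hGim : ∀ θ, HasDerivAt (fun θ => (G θ).im) ((conj A * B).im / Complex.normSq (F θ)) θ := by
    intro θ
    have := (Complex.imCLM.hasFDerivAt.comp_hasDerivAt θ (hGd θ))
    refine this.congr_deriv ?_
    have hid := Real.sin_sq_add_cos_sq θ
    rw [Complex.imCLM_apply, Complex.div_im]
    rw [← sub_div]
    congr 1
    simp [hF, hF', -Complex.ofReal_sin, -Complex.ofReal_cos]
    linear_combination (A.re * B.im - A.im * B.re) * hid
  refine ⟨fun θ => A.arg + (G θ).im, ?_, ?_, ?_, ?_⟩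
  · exact continuous_const.add (continuous_iff_continuousAt.2 fun θ => (hGim θ).continuousAt)
  · intro θ
    have hA : A ≠ 0 := by simpa using h 0
    have hFA : F θ = A * Complex.exp (G θ) := by
      rw [← hE θ, mul_assoc, ← Complex.exp_add]; simp
    have h2 : ((F θ).arg : Real.Angle) = ((A.arg + (G θ).im : ℝ) : Real.Angle) := by
      rw [hFA, Complex.arg_mul_coe_angle hA (Complex.exp_ne_zero _), Complex.arg_exp,
        ← Real.Angle.toReal_coe, Real.Angle.coe_toReal]
      rfl
    rw [Real.Angle.angle_eq_iff_two_pi_dvd_sub] at h2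
    obtain ⟨k, hk⟩ := h2
    have h3 : (F θ).arg = A.arg + (G θ).im + (2 * k : ℤ) • Real.pi := by
      rw [zsmul_eq_mul]; push_cast; linarith
    change _ = ((F θ).arg : AddCircle Real.pi)
    rw [h3, AddCircle.coe_add _ _ (_ • _), AddCircle.coe_zsmul, AddCircle.coe_period, smul_zero,
      add_zero]
  · intro hpos
    have : StrictMono fun θ => (G θ).im := strictMono_of_deriv_pos fun θ => by
      rw [(hGim θ).deriv]
      exact div_pos hpos (Complex.normSq_pos.2 (h θ))
    simpa using this Real.pi_pos
  · intro hneg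
    have : StrictAnti fun θ => (G θ).im := strictAnti_of_deriv_neg fun θ => by
      rw [(hGim θ).deriv]
      exact div_neg_of_neg_of_pos hneg (Complex.normSq_pos.2 (h θ))
    simpa using this Real.pi_pos

/-- Two continuous lifts to `ℝ` of the same map to a circle have the same increments. -/
theorem lift_sub_eq {p : ℝ} [hp : Fact (0 < p)] {a b : ℝ → ℝ} (ha : Continuous a) (hb : Continuous b)
    (hab : ∀ θ, (a θ : AddCircle p) = b θ) (θ η : ℝ) : a θ - b θ = a η - b η := by
  -- The difference of the lifts is `p` times an integer that varies continuously, hence is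
  -- constant.
  have hk : ∀ θ, ∃ k : ℤ, (k : ℝ) = (a θ - b θ) / p := by
    intro θ
    have h0 : ((a θ - b θ : ℝ) : AddCircle p) = 0 := by rw [AddCircle.coe_sub, hab, sub_self]
    obtain ⟨k, hk⟩ := (AddCircle.coe_eq_zero_iff p).1 h0
    exact ⟨k, by rw [← hk, zsmul_eq_mul, mul_div_cancel_right₀ _ hp.out.ne']⟩
  choose k hk using hk
  have hc : Continuous fun θ => (k θ : ℝ) := by
    simp only [hk]; fun_prop
  have hkc : Continuous k := Int.isClosedEmbedding_coe_real.isEmbedding.continuous_iff.2 hc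
  have hconst := (IsPreconnected.constant (isPreconnected_univ (α := ℝ)) hkc.continuousOn
    (Set.mem_univ θ) (Set.mem_univ η))
  have := congrArg (fun m : ℤ => (m : ℝ)) hconst
  simp only [hk] at this
  exact (div_left_inj' hp.out.ne').1 this

/-- The winding direction is the orientation of the pair `(A, B)`. By `lift_sub_eq` the explicit
lift decides for all lifts. -/
theorem isPositiveLoop_iff {A B : ℂ} (h : ∀ θ : ℝ, Real.cos θ • A + Real.sin θ • B ≠ 0)
    {g : AddCircle Real.pi → AddCircle Real.pi}
    (hg : ∀ θ : ℝ, g θ = ((Real.cos θ • A + Real.sin θ • B).arg : ℝ)) :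
    IsPositiveLoop g ↔ 0 < (conj A * B).im := by
  obtain ⟨a, hac, ha, hpos, hneg⟩ := exists_arg_lift h
  refine ⟨fun ⟨b, hbc, hb, hlt⟩ => ?_, fun h0 => ⟨a, hac, fun θ => by rw [ha, hg], hpos h0⟩⟩
  rcases lt_or_gt_of_ne (im_conj_mul_ne_zero h) with h0 | h0
  · have : Fact (0 < Real.pi) := ⟨Real.pi_pos⟩
    have := lift_sub_eq (p := Real.pi) hac hbc (fun θ => by rw [ha, hb, hg]) 0 Real.pi
    linarith [hneg h0]
  · exact h0

/-! ### The decomposition into types -/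

theorem form_sum_apply {ι : Type*} (s : Finset ι) (F : ι → V [⋀^Fin n]→ₗ[ℝ] ℂ) (v : Fin n → V) :
    (∑ i ∈ s, F i) v = ∑ i ∈ s, F i v := by
  induction s using Finset.cons_induction with
  | empty => simp
  | cons i s hi ih => simp [ih]

theorem wedgeOneForms_apply (ℓ : Fin n → V →ₗ[ℝ] ℂ) (v : Fin n → V) :
    wedgeOneForms ℓ v = Matrix.det (Matrix.of fun i j => ℓ j (v i)) := rfl

theorem wedgeOneForms_add (ℓ ℓ' : Fin n → V →ₗ[ℝ] ℂ) :
    wedgeOneForms (fun i => ℓ i + ℓ' i) =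
      ∑ s : Finset (Fin n), wedgeOneForms (s.piecewise ℓ ℓ') := by
  ext v
  have h : ∀ ℓ : Fin n → V →ₗ[ℝ] ℂ, wedgeOneForms ℓ v =
      Matrix.detRowAlternating (R := ℂ) (fun j i => ℓ j (v i)) := by
    intro ℓ
    rw [wedgeOneForms_apply, ← Matrix.det_transpose]
    rfl
  rw [h, form_sum_apply]
  have := (Matrix.detRowAlternating (n := Fin n) (R := ℂ)).toMultilinearMap.map_add_univ
    (fun j i => ℓ j (v i)) (fun j i => ℓ' j (v i))
  refine Eq.trans ?_ (this.trans (Finset.sum_congr rfl fun s _ => ?_))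
  · rfl
  · rw [h]
    change Matrix.detRowAlternating _ = Matrix.detRowAlternating _
    congr 1
    ext j i
    by_cases hj : j ∈ s <;> simp [hj]

/-- Every form is a combination of exterior products of one-forms. -/
theorem mem_span_wedgeOneForms [FiniteDimensional ℝ V] (Ω : V [⋀^Fin n]→ₗ[ℝ] ℂ) :
    Ω ∈ Submodule.span ℂ (Set.range (wedgeOneForms (V := V) (n := n))) := by
  set b := Module.finBasis ℝ V
  set coord : Fin (Module.finrank ℝ V) → V →ₗ[ℝ] ℂ := fun a =>
    (Algebra.linearMap ℝ ℂ).comp (b.coord a)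
  have expand : ∀ v : Fin n → V, Ω v =
      ∑ f : Fin n → Fin (Module.finrank ℝ V), (∏ i, coord (f i) (v i)) * Ω (fun i => b (f i)) := by
    intro v
    have hv : v = fun i => ∑ a, b.coord a (v i) • b a := by
      funext i
      simp only [Module.Basis.coord_apply, b.sum_repr]
    conv_lhs => rw [hv]
    rw [← AlternatingMap.coe_multilinearMap, MultilinearMap.map_sum]
    refine Finset.sum_congr rfl fun f _ => ?_
    rw [MultilinearMap.map_smul_univ, Complex.real_smul, Complex.ofReal_prod]
    rfl
  -- Antisymmetrizing the expansion in coordinates turns each product of coordinates into a wedge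
  -- and, as `Ω` is alternating, multiplies the left side by `n!`.
  have hΩ : Ω = ((n.factorial : ℂ)⁻¹) • ∑ f : Fin n → Fin (Module.finrank ℝ V),
      Ω (fun i => b (f i)) • wedgeOneForms fun i => coord (f i) := by
    ext v
    have hsum : ∑ f : Fin n → Fin (Module.finrank ℝ V),
        Ω (fun i => b (f i)) * wedgeOneForms (fun i => coord (f i)) v = n.factorial * Ω v := by
      calc _ = ∑ f : Fin n → Fin (Module.finrank ℝ V), ∑ τ : Equiv.Perm (Fin n),
            Equiv.Perm.sign τ • ((∏ i, coord (f i) (v (τ i))) * Ω (fun i => b (f i))) := by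
            refine Finset.sum_congr rfl fun f _ => ?_
            rw [wedgeOneForms_apply, Matrix.det_apply, Finset.mul_sum]
            refine Finset.sum_congr rfl fun τ _ => ?_
            rw [mul_smul_comm, mul_comm]
            rfl
        _ = ∑ τ : Equiv.Perm (Fin n), Equiv.Perm.sign τ • Ω (v ∘ τ) := by
            rw [Finset.sum_comm]
            refine Finset.sum_congr rfl fun τ _ => ?_
            rw [expand, Finset.smul_sum]
            rfl
        _ = ∑ τ : Equiv.Perm (Fin n), Ω v := by
            refine Finset.sum_congr rfl fun τ _ => ?_
            rw [AlternatingMap.map_perm]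
            rcases Int.units_eq_one_or (Equiv.Perm.sign τ) with h | h <;> simp [h]
        _ = _ := by simp [Fintype.card_perm]
    have hn : (n.factorial : ℂ) ≠ 0 := by exact_mod_cast n.factorial_ne_zero
    simp only [AlternatingMap.smul_apply, form_sum_apply, smul_eq_mul, hsum]
    rw [inv_mul_cancel_left₀ hn]
  rw [hΩ]
  exact Submodule.smul_mem _ _ (Submodule.sum_mem _ fun f _ => Submodule.smul_mem _ _
    (Submodule.subset_span ⟨_, rfl⟩))

/-- The complex linear part of an `ℝ`-linear one-form. -/
def linearPart (J : V →ₗ[ℝ] V) (ℓ : V →ₗ[ℝ] ℂ) : V →ₗ[ℝ] ℂ :=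
  (2⁻¹ : ℂ) • (ℓ - Complex.I • ℓ.comp J)

/-- The complex antilinear part of an `ℝ`-linear one-form. -/
def antilinearPart (J : V →ₗ[ℝ] V) (ℓ : V →ₗ[ℝ] ℂ) : V →ₗ[ℝ] ℂ :=
  (2⁻¹ : ℂ) • (ℓ + Complex.I • ℓ.comp J)

theorem linearPart_add_antilinearPart (J : V →ₗ[ℝ] V) (ℓ : V →ₗ[ℝ] ℂ) :
    linearPart J ℓ + antilinearPart J ℓ = ℓ := by
  ext x
  simp [linearPart, antilinearPart]
  ring

section Compatible

variable {ω : V [⋀^Fin 2]→ₗ[ℝ] ℝ} {J : V →ₗ[ℝ] V}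

theorem linearPart_J (hJ : IsCompatible ω J) (ℓ : V →ₗ[ℝ] ℂ) (x : V) :
    linearPart J ℓ (J x) = Complex.I * linearPart J ℓ x := by
  simp [linearPart, hJ.sq_eq_neg]
  linear_combination (2⁻¹ * ℓ (J x)) * Complex.I_mul_I

theorem antilinearPart_J (hJ : IsCompatible ω J) (ℓ : V →ₗ[ℝ] ℂ) (x : V) :
    antilinearPart J ℓ (J x) = -(Complex.I * antilinearPart J ℓ x) := by
  simp [antilinearPart, hJ.sq_eq_neg]
  linear_combination (2⁻¹ * ℓ (J x)) * Complex.I_mul_I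

/-- Split every one-form of a wedge into its linear and antilinear parts and expand. -/
theorem iSup_typeForms [FiniteDimensional ℝ V] (hJ : IsCompatible ω J) :
    ⨆ k : Fin (n + 1), typeForms J n k = ⊤ := by
  refine eq_top_iff.2 fun Ω _ => ?_
  refine Submodule.span_le.2 ?_ (mem_span_wedgeOneForms Ω)
  rintro _ ⟨ℓ, rfl⟩
  have : ℓ = fun i => linearPart J (ℓ i) + antilinearPart J (ℓ i) :=
    funext fun i => (linearPart_add_antilinearPart J (ℓ i)).symm
  rw [this, wedgeOneForms_add]
  refine Submodule.sum_mem _ fun s _ => ?_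
  have hs : s.card < n + 1 := by
    have := s.card_le_univ
    rw [Fintype.card_fin] at this
    omega
  refine Submodule.mem_iSup_of_mem ⟨s.card, hs⟩ (Submodule.subset_span ⟨_, s, rfl, ?_, ?_, rfl⟩)
  · intro i hi x
    simp [hi, linearPart_J hJ]
  · intro i hi x
    simp [hi, antilinearPart_J hJ]

/-- The character by which `e^{iθ}` acts on forms of type `(k, n - k)`. -/
def typeCharacter (n k : ℕ) (θ : ℝ) : ℂ :=
  Complex.exp ((2 * k - n : ℂ) * θ * Complex.I)

/-- In the determinant, `k` columns are multiplied by `e^{iθ}` and `n - k` by `e^{-iθ}`. -/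
theorem comp_rotation_of_mem_typeForms {k : ℕ} {Ω : V [⋀^Fin n]→ₗ[ℝ] ℂ}
    (hΩ : Ω ∈ typeForms J n k) (θ : ℝ) :
    Ω.compLinearMap (rotation J θ) = typeCharacter n k θ • Ω := by
  induction hΩ using Submodule.span_induction with
  | mem Ω h =>
    obtain ⟨ℓ, s, hs, h1, h2, rfl⟩ := h
    ext v
    have hℓ : ∀ i j, ℓ j (rotation J θ (v i)) =
        (if j ∈ s then Complex.exp (θ * Complex.I) else Complex.exp (-(θ * Complex.I))) *
          ℓ j (v i) := by
      intro i j
      rw [rotation_apply, map_add, map_smul, map_smul, Complex.real_smul, Complex.real_smul]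
      split_ifs with hj
      · rw [h1 j hj, Complex.exp_mul_I, Complex.ofReal_cos, Complex.ofReal_sin]
        ring
      · rw [h2 j hj, ← neg_mul (θ : ℂ), Complex.exp_mul_I, Complex.cos_neg, Complex.sin_neg,
          Complex.ofReal_cos, Complex.ofReal_sin]
        ring
    simp only [AlternatingMap.compLinearMap_apply, AlternatingMap.smul_apply, wedgeOneForms_apply,
      hℓ, smul_eq_mul]
    rw [show (Matrix.of fun i j => (if j ∈ s then Complex.exp (θ * Complex.I)
        else Complex.exp (-(θ * Complex.I))) * ℓ j (v i)) = Matrix.of fun i j =>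
        (fun j => if j ∈ s then Complex.exp (θ * Complex.I)
        else Complex.exp (-(θ * Complex.I))) j * (Matrix.of fun i j => ℓ j (v i)) i j from rfl,
      Matrix.det_mul_row]
    congr 1
    have hk : k ≤ n := by
      have := s.card_le_univ
      rwa [hs, Fintype.card_fin] at this
    rw [Finset.prod_ite, Finset.prod_const, Finset.prod_const, ← Complex.exp_nat_mul,
      ← Complex.exp_nat_mul, ← Complex.exp_add, typeCharacter, Finset.filter_mem_eq_inter,
      Finset.univ_inter, Finset.filter_not, Finset.filter_mem_eq_inter, Finset.univ_inter,
      Finset.card_sdiff_of_subset (Finset.subset_univ s), Finset.card_univ, Fintype.card_fin, hs,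
      Nat.cast_sub hk]
    congr 1
    ring
  | zero => ext; simp
  | add Ω Ω' _ _ h h' =>
    rw [smul_add, ← h, ← h']
    rfl
  | smul c Ω _ h =>
    rw [smul_comm, ← h]
    rfl

/-- The component of type `(k, n - k)`, as an average over rotations. -/
def typeComponent (J : V →ₗ[ℝ] V) (k : ℕ) :
    (V [⋀^Fin n]→ₗ[ℝ] ℂ) →ₗ[ℂ] V [⋀^Fin n]→ₗ[ℝ] ℂ where
  -- The exponents `2k - n` all have the same parity, so `n + 1` equally spaced angles in `[0, π)`
  -- separate the `n + 1` types.
  toFun Ω := ∑ m ∈ Finset.range (n + 1),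
    ((n + 1 : ℂ)⁻¹ * (typeCharacter n k (Real.pi * m / (n + 1)))⁻¹) •
      Ω.compLinearMap (rotation J (Real.pi * m / (n + 1)))
  map_add' Ω Ω' := by
    rw [← Finset.sum_add_distrib]
    refine Finset.sum_congr rfl fun m _ => ?_
    rw [← smul_add]
    rfl
  map_smul' c Ω := by
    rw [Finset.smul_sum]
    refine Finset.sum_congr rfl fun m _ => ?_
    rw [smul_comm]
    rfl

theorem typeComponent_apply (J : V →ₗ[ℝ] V) (k : ℕ) (Ω : V [⋀^Fin n]→ₗ[ℝ] ℂ) :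
    typeComponent J k Ω = ∑ m ∈ Finset.range (n + 1),
      ((n + 1 : ℂ)⁻¹ * (typeCharacter n k (Real.pi * m / (n + 1)))⁻¹) •
        Ω.compLinearMap (rotation J (Real.pi * m / (n + 1))) := rfl

/-- Orthogonality of characters: the terms are the powers of `ζ^(j-k)` with `ζ` a primitive root of
unity of order `n + 1`. -/
theorem sum_typeCharacter {j k : ℕ} (hj : j < n + 1) (hk : k < n + 1) :
    ∑ m ∈ Finset.range (n + 1), (typeCharacter n k (Real.pi * m / (n + 1)))⁻¹ *
      typeCharacter n j (Real.pi * m / (n + 1)) = if j = k then (n + 1 : ℂ) else 0 := by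
  have hn : (n + 1 : ℂ) ≠ 0 := by exact_mod_cast n.succ_ne_zero
  set ζ := Complex.exp (2 * Real.pi * Complex.I / (n + 1 : ℕ)) with hζ
  have hprim : IsPrimitiveRoot ζ (n + 1) := Complex.isPrimitiveRoot_exp _ n.succ_ne_zero
  have hζ0 : ζ ≠ 0 := Complex.exp_ne_zero _
  have hterm : ∀ m : ℕ, (typeCharacter n k (Real.pi * m / (n + 1)))⁻¹ *
      typeCharacter n j (Real.pi * m / (n + 1)) = (ζ ^ j / ζ ^ k) ^ m := by
    intro m
    rw [typeCharacter, typeCharacter, ← Complex.exp_neg, ← Complex.exp_add, hζ,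
      ← Complex.exp_nat_mul, ← Complex.exp_nat_mul, ← Complex.exp_sub, ← Complex.exp_nat_mul]
    congr 1
    push_cast
    field_simp
    ring
  simp only [hterm]
  split_ifs with hjk
  · subst hjk
    simp [div_self (pow_ne_zero j hζ0)]
  · have hw : ζ ^ j / ζ ^ k ≠ 1 := by
      rw [Ne, div_eq_one_iff_eq (pow_ne_zero k hζ0)]
      exact fun h => hjk (hprim.pow_inj hj hk h)
    rw [geom_sum_eq hw, div_pow, ← pow_mul, ← pow_mul, mul_comm j, mul_comm k, pow_mul, pow_mul,
      hprim.pow_eq_one]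
    simp

theorem typeComponent_of_mem {j k : ℕ} (hj : j < n + 1) (hk : k < n + 1)
    {Ω : V [⋀^Fin n]→ₗ[ℝ] ℂ} (hΩ : Ω ∈ typeForms J n j) :
    typeComponent J k Ω = if j = k then Ω else 0 := by
  have hn : (n + 1 : ℂ) ≠ 0 := by exact_mod_cast n.succ_ne_zero
  simp only [typeComponent_apply, comp_rotation_of_mem_typeForms hΩ, smul_smul, mul_assoc]
  rw [← Finset.sum_smul, ← Finset.mul_sum, sum_typeCharacter hj hk]
  split_ifs with h <;> simp [hn]

theorem typeComponent_mem [FiniteDimensional ℝ V] (hJ : IsCompatible ω J) {k : ℕ} (hk : k < n + 1)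
    (Ω : V [⋀^Fin n]→ₗ[ℝ] ℂ) : typeComponent J k Ω ∈ typeForms J n k := by
  have h : Ω ∈ ⨆ k : Fin (n + 1), typeForms J n k := iSup_typeForms hJ ▸ Submodule.mem_top
  induction h using Submodule.iSup_induction' with
  | mem j Ω hΩ =>
    rw [typeComponent_of_mem j.2 hk hΩ]
    split_ifs with h
    · exact h ▸ hΩ
    · exact Submodule.zero_mem _
  | zero => simp
  | add Ω Ω' _ _ h h' => rw [map_add]; exact Submodule.add_mem _ h h'

theorem sum_typeComponent [FiniteDimensional ℝ V] (hJ : IsCompatible ω J)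
    (Ω : V [⋀^Fin n]→ₗ[ℝ] ℂ) : ∑ k : Fin (n + 1), typeComponent J k Ω = Ω := by
  have h : Ω ∈ ⨆ k : Fin (n + 1), typeForms J n k := iSup_typeForms hJ ▸ Submodule.mem_top
  induction h using Submodule.iSup_induction' with
  | mem j Ω hΩ =>
    have : ∀ k : Fin (n + 1), typeComponent J k Ω = if j = k then Ω else 0 := fun k => by
      rw [typeComponent_of_mem j.2 k.2 hΩ]; simp [Fin.ext_iff]
    simp [this]
  | zero => simp
  | add Ω Ω' _ _ h h' => simp only [map_add, Finset.sum_add_distrib, h, h']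

theorem isTypeDecomposition_iff [FiniteDimensional ℝ V] (hJ : IsCompatible ω J)
    (Ω : V [⋀^Fin n]→ₗ[ℝ] ℂ) (d : Fin (n + 1) → V [⋀^Fin n]→ₗ[ℝ] ℂ) :
    IsTypeDecomposition J Ω d ↔ d = fun k : Fin (n + 1) => typeComponent J k Ω := by
  constructor
  · rintro ⟨hd, rfl⟩
    funext k
    have : ∀ j : Fin (n + 1), typeComponent J k (d j) = if j = k then d j else 0 := fun j => by
      rw [typeComponent_of_mem j.2 k.2 (hd j)]; simp [Fin.ext_iff]
    simp [map_sum, this]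
  · rintro rfl
    exact ⟨fun k => typeComponent_mem hJ k.2 Ω, sum_typeComponent hJ Ω⟩

/-- The component is a combination of pullbacks of `Ω` under rotations, and these preserve `ω`. -/
theorem isPrimitive_typeComponent (hJ : IsCompatible ω J) {Ω : V [⋀^Fin n]→ₗ[ℝ] ℂ}
    (hΩ : IsPrimitive ω Ω) (k : ℕ) : IsPrimitive ω (typeComponent J k Ω) := by
  change wedgeLeft ω (typeComponent J k Ω) = 0
  rw [typeComponent_apply, map_sum]
  refine Finset.sum_eq_zero fun m _ => ?_
  have : wedgeLeft ω (Ω.compLinearMap (rotation J (Real.pi * m / (n + 1)))) = 0 :=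
    hΩ.comp_rotation hJ _
  rw [map_smul, this, smul_zero]

/-! ### Continuity in the topology of pointwise convergence -/

theorem continuous_apply_form (v : Fin n → V) : Continuous fun Ω : V [⋀^Fin n]→ₗ[ℝ] ℂ => Ω v :=
  (continuous_apply v).comp continuous_induced_dom

theorem continuous_form_iff {X : Type*} [TopologicalSpace X] {F : X → V [⋀^Fin n]→ₗ[ℝ] ℂ} :
    Continuous F ↔ ∀ v, Continuous fun x => F x v := by
  rw [continuous_induced_rng, continuous_pi_iff]
  rfl

theorem continuous_typeComponent (k : ℕ) (v : Fin n → V) :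
    Continuous fun Ω : V [⋀^Fin n]→ₗ[ℝ] ℂ => typeComponent J k Ω v := by
  simp only [typeComponent_apply, form_sum_apply, AlternatingMap.smul_apply,
    AlternatingMap.compLinearMap_apply, smul_eq_mul]
  exact continuous_finsetSum _ fun m _ => continuous_const.mul (continuous_apply_form _)

/-- Forms of type `(n, 0)` are complex linear in each argument. -/
theorem apply_update_J_of_mem_typeForms {Ω : V [⋀^Fin n]→ₗ[ℝ] ℂ} (hΩ : Ω ∈ typeForms J n n)
    (v : Fin n → V) (i : Fin n) (x : V) :
    Ω (Function.update v i (J x)) = Complex.I * Ω (Function.update v i x) := by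
  induction hΩ using Submodule.span_induction with
  | mem Ω h =>
    obtain ⟨ℓ, s, hs, h1, -, rfl⟩ := h
    have hs : s = Finset.univ := by
      rw [← Finset.card_eq_iff_eq_univ, hs, Fintype.card_fin]
    subst hs
    have h : ∀ z, (Matrix.of fun a j => ℓ j (Function.update v i z a)) =
        Matrix.updateRow (Matrix.of fun a j => ℓ j (v a)) i (fun j => ℓ j z) := by
      intro z
      ext a j
      by_cases ha : a = i
      · subst ha; simp
      · simp [ha]
    rw [wedgeOneForms_apply, wedgeOneForms_apply, h, h, ← Matrix.det_updateRow_smul]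
    congr 2
    ext j
    simp [h1]
  | zero => simp
  | add Ω Ω' _ _ h h' => simp [h, h', mul_add]
  | smul c Ω _ h => simp [h, mul_left_comm]

end Compatible

/-! ### Positivity on symplectic bases -/

section Positive

variable [NeZero n] {ω : V [⋀^Fin 2]→ₗ[ℝ] ℝ} {J : V →ₗ[ℝ] V} {e f : Fin n → V}
  {Ω : V [⋀^Fin n]→ₗ[ℝ] ℂ}

theorem stdFrame_zero (e f : Fin n → V) : stdFrame e f 0 = e := by
  simp [stdFrame]

theorem apply_stdFrame (Ω : V [⋀^Fin n]→ₗ[ℝ] ℂ) (e f : Fin n → V) (θ : ℝ) :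
    Ω (stdFrame e f θ) = Real.cos θ • Ω e + Real.sin θ • Ω (Function.update e 0 (f 0)) := by
  rw [stdFrame, AlternatingMap.map_update_add, AlternatingMap.map_update_smul,
    AlternatingMap.map_update_smul, Function.update_eq_self]

theorem apply_stdFrame_ne_zero (hΩ : Ω ∈ U ω n) (h : IsSymplecticBasis ω e f) (θ : ℝ) :
    Ω (stdFrame e f θ) ≠ 0 :=
  ((stdLagrangian h θ).restrict_ne_zero_iff rfl Ω).1 (hΩ.2 _)

theorem apply_ne_zero_of_mem_U (hΩ : Ω ∈ U ω n) (h : IsSymplecticBasis ω e f) : Ω e ≠ 0 := by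
  simpa [stdFrame_zero] using apply_stdFrame_ne_zero hΩ h 0

theorem im_ne_zero_of_mem_U (hΩ : Ω ∈ U ω n) (h : IsSymplecticBasis ω e f) :
    (conj (Ω e) * Ω (Function.update e 0 (f 0))).im ≠ 0 :=
  im_conj_mul_ne_zero fun θ => by
    rw [← apply_stdFrame]
    exact apply_stdFrame_ne_zero hΩ h θ

theorem isPositiveLoop_stdLoop_iff (hΩ : Ω ∈ U ω n) (h : IsSymplecticBasis ω e f) :
    IsPositiveLoop (phase Ω ∘ stdLoop h) ↔
      0 < (conj (Ω e) * Ω (Function.update e 0 (f 0))).im := by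
  refine isPositiveLoop_iff (fun θ => ?_) (fun θ => ?_)
  · rw [← apply_stdFrame]
    exact apply_stdFrame_ne_zero hΩ h θ
  · rw [← apply_stdFrame]
    exact phase_eq (stdLagrangian h θ) rfl (apply_stdFrame_ne_zero hΩ h θ)

/-- Trades the topological condition on loops for an inequality between values of `Ω`, which is what
the rest of the proof uses. -/
theorem mem_UPlus_iff : Ω ∈ UPlus ω n ↔ Ω ∈ U ω n ∧ ∀ e f : Fin n → V,
    IsSymplecticBasis ω e f → 0 < (conj (Ω e) * Ω (Function.update e 0 (f 0))).im :=
  and_congr_right fun hΩ => forall_congr' fun _ => forall_congr' fun _ =>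
    forall_congr' fun h => isPositiveLoop_stdLoop_iff hΩ h

/-- Exchanging the indices `0` and `j` gives another symplectic basis; the sign of the transposition
occurs in both factors and cancels. -/
theorem im_pos_of_mem_UPlus (hΩ : Ω ∈ UPlus ω n) (h : IsSymplecticBasis ω e f) (j : Fin n) :
    0 < (conj (Ω e) * Ω (Function.update e j (f j))).im := by
  have := (mem_UPlus_iff.1 hΩ).2 _ _ (h.reindex (Equiv.swap 0 j))
  have e1 : Function.update (e ∘ Equiv.swap 0 j) 0 ((f ∘ Equiv.swap 0 j) 0) =
      Function.update e j (f j) ∘ Equiv.swap 0 j := by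
    rw [Function.update_comp_equiv]
    simp
  rw [e1, AlternatingMap.map_perm, AlternatingMap.map_perm] at this
  rcases Int.units_eq_one_or (Equiv.Perm.sign (Equiv.swap 0 j)) with h | h <;>
    simpa [h] using this

theorem LGr.exists_unitary_frame (hJ : IsCompatible ω J) (L : LGr ω n) :
    ∃ e : Fin n → V, Submodule.span ℝ (Set.range e) = L.1 ∧
      IsSymplecticBasis ω e (fun i => J (e i)) := by
  have := L.finiteDimensional
  obtain ⟨e, he, h⟩ := hJ.exists_unitary_frame_mem L.1 L.2.1 n L.2.2.ge
  have hli : LinearIndependent ℝ e := by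
    simpa using h.linearIndependent.comp Sum.inl Sum.inl_injective
  refine ⟨e, Submodule.eq_of_le_of_finrank_eq ?_ ?_, h⟩
  · rw [Submodule.span_le]
    rintro _ ⟨i, rfl⟩
    exact he i
  · rw [finrank_span_eq_card hli, Fintype.card_fin, L.2.2]

theorem mem_U_of_unitary_frames (hJ : IsCompatible ω J) (hΩ : IsPrimitive ω Ω)
    (h : ∀ e : Fin n → V, IsSymplecticBasis ω e (fun i => J (e i)) → Ω e ≠ 0) : Ω ∈ U ω n := by
  refine ⟨hΩ, fun L => ?_⟩
  obtain ⟨e, heL, he⟩ := L.exists_unitary_frame hJ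
  exact (L.restrict_ne_zero_iff heL Ω).2 (h e he)

end Positive

/-! ### The complexification of a form in a frame -/

/-- The complex multilinear extension of `Ω`, evaluated at the vectors
`x_j.1 (e_j - i J e_j) / 2 + x_j.2 (e_j + i J e_j) / 2` of the complexification of `V`. -/
def frameForm (J : V →ₗ[ℝ] V) (Ω : V [⋀^Fin n]→ₗ[ℝ] ℂ) (e : Fin n → V) :
    MultilinearMap ℂ (fun _ : Fin n => ℂ × ℂ) ℂ :=
  ∑ s : Finset (Fin n), Ω (s.piecewise e fun i => J (e i)) •
    (MultilinearMap.mkPiAlgebra ℂ (Fin n) ℂ).compLinearMap fun j =>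
      -- The coefficients of `e_j` and `J e_j` after collecting terms in the vector of the
      -- docstring.
      if j ∈ s then (2⁻¹ : ℂ) • (LinearMap.fst ℂ ℂ ℂ + LinearMap.snd ℂ ℂ ℂ)
      else (-(Complex.I / 2) : ℂ) • (LinearMap.fst ℂ ℂ ℂ - LinearMap.snd ℂ ℂ ℂ)

theorem frameForm_apply (J : V →ₗ[ℝ] V) (Ω : V [⋀^Fin n]→ₗ[ℝ] ℂ) (e : Fin n → V)
    (x : Fin n → ℂ × ℂ) : frameForm J Ω e x =
      ∑ s : Finset (Fin n), Ω (s.piecewise e fun i => J (e i)) *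
        ∏ j, if j ∈ s then 2⁻¹ * ((x j).1 + (x j).2)
          else -(Complex.I / 2) * ((x j).1 - (x j).2) := by
  simp only [frameForm, _root_.sum_apply, _root_.smul_apply,
    MultilinearMap.compLinearMap_apply, MultilinearMap.mkPiAlgebra_apply, smul_eq_mul]
  refine Finset.sum_congr rfl fun s _ => ?_
  congr 1
  refine Finset.prod_congr rfl fun j _ => ?_
  split_ifs <;> simp [mul_add]

theorem continuous_frameForm (J : V →ₗ[ℝ] V) (Ω : V [⋀^Fin n]→ₗ[ℝ] ℂ) (e : Fin n → V) :
    Continuous (frameForm J Ω e) := by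
  have : ⇑(frameForm J Ω e) = _ := funext (frameForm_apply J Ω e)
  rw [this]
  refine continuous_finsetSum _ fun s _ => continuous_const.mul
    (continuous_finsetProd _ fun j _ => ?_)
  split_ifs <;> fun_prop

/-- The point of `ℂ²` that corresponds to `e^{iθ}`. -/
def rotationPair (θ : ℝ) : ℂ × ℂ :=
  (Complex.exp (θ * Complex.I), Complex.exp (-(θ * Complex.I)))

/-- At `(e^{iθ}, e^{-iθ})` the coefficients of `e_j` and `J e_j` become `cos θ` and `sin θ`. -/
theorem frameForm_rotationPair (J : V →ₗ[ℝ] V) (Ω : V [⋀^Fin n]→ₗ[ℝ] ℂ) (e : Fin n → V)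
    (θ : Fin n → ℝ) : frameForm J Ω e (fun j => rotationPair (θ j)) =
      Ω fun j => rotation J (θ j) (e j) := by
  have hexp : ∀ t : ℝ, Complex.exp (-(t * Complex.I)) = Complex.cos t - Complex.sin t * Complex.I := by
    intro t
    rw [← neg_mul, Complex.exp_mul_I, Complex.cos_neg, Complex.sin_neg]
    ring
  have h := Ω.toMultilinearMap.map_add_univ (fun j => Real.cos (θ j) • e j)
    (fun j => Real.sin (θ j) • J (e j))
  refine Eq.trans ?_ h.symm
  rw [frameForm_apply]
  refine Finset.sum_congr rfl fun s _ => ?_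
  have hs : s.piecewise (fun j => Real.cos (θ j) • e j) (fun j => Real.sin (θ j) • J (e j)) =
      fun j => (if j ∈ s then Real.cos (θ j) else Real.sin (θ j)) •
        s.piecewise e (fun i => J (e i)) j := by
    ext j
    by_cases hj : j ∈ s <;> simp [hj]
  rw [hs, MultilinearMap.map_smul_univ, Complex.real_smul, mul_comm, Complex.ofReal_prod]
  refine congrArg₂ _ (Finset.prod_congr rfl fun j _ => ?_) rfl
  split_ifs
  · rw [rotationPair, hexp, Complex.exp_mul_I, Complex.ofReal_cos]
    ring
  · rw [rotationPair, hexp, Complex.exp_mul_I, Complex.ofReal_sin]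
    linear_combination -Complex.sin (θ j) * Complex.I_mul_I

theorem exists_eq_smul_rotationPair {p : ℂ × ℂ} (h : ‖p.2‖ = ‖p.1‖) (h0 : p.1 ≠ 0) :
    ∃ (c : ℂ) (θ : ℝ), c ≠ 0 ∧ p = c • rotationPair θ := by
  have h2 : p.2 ≠ 0 := by rw [← norm_pos_iff, h, norm_pos_iff]; exact h0
  have hq : Complex.exp ((p.1 / p.2).arg * Complex.I) = p.1 / p.2 := by
    have := Complex.norm_mul_exp_arg_mul_I (p.1 / p.2)
    rwa [norm_div, h, div_self (norm_ne_zero_iff.2 h0), Complex.ofReal_one, one_mul] at this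
  set θ := (p.1 / p.2).arg with hθ
  refine ⟨p.1 * Complex.exp (-((θ / 2 : ℝ) * Complex.I)), θ / 2,
    mul_ne_zero h0 (Complex.exp_ne_zero _), Prod.ext ?_ ?_⟩
  · simp only [rotationPair, Prod.smul_fst, smul_eq_mul]
    rw [mul_assoc, ← Complex.exp_add]
    simp
  · simp only [rotationPair, Prod.smul_snd, smul_eq_mul]
    rw [mul_assoc, ← Complex.exp_add, show -(((θ / 2 : ℝ) : ℂ) * Complex.I) +
      -(((θ / 2 : ℝ) : ℂ) * Complex.I) = -(θ * Complex.I) by push_cast; ring, Complex.exp_neg, hq]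
    field_simp

/-! ### Absence of zeros in the closed polydisc -/

section Roots

variable [NeZero n] {ω : V [⋀^Fin 2]→ₗ[ℝ] ℝ} {J : V →ₗ[ℝ] V} {e : Fin n → V}
  {Ω : V [⋀^Fin n]→ₗ[ℝ] ℂ}

/-- With `a = uα` and `b = wβ`, the values of `Ω` on the rotated frame and on the same frame with
`J` applied to the `j`-th vector are `a + b` and `i (a - b)`. Positivity reads `Im (conj (a + b) * i
(a - b)) = |a|² - |b|² > 0`. -/
theorem frameForm_update_norm_lt (hJ : IsCompatible ω J) (hΩ : Ω ∈ UPlus ω n)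
    (he : IsSymplecticBasis ω e (fun i => J (e i))) (θ : Fin n → ℝ) (j : Fin n) :
    ‖frameForm J Ω e (Function.update (fun j => rotationPair (θ j)) j (0, 1))‖ <
      ‖frameForm J Ω e (Function.update (fun j => rotationPair (θ j)) j (1, 0))‖ := by
  set α := frameForm J Ω e (Function.update (fun j => rotationPair (θ j)) j (1, 0))
  set β := frameForm J Ω e (Function.update (fun j => rotationPair (θ j)) j (0, 1))
  set u := Complex.exp (θ j * Complex.I) with hu
  set w := Complex.exp (-(θ j * Complex.I)) with hw
  have hpos := im_pos_of_mem_UPlus hΩ (he.rotate hJ θ) j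
  have hval : ∀ t : ℝ, Ω (Function.update (fun i => rotation J (θ i) (e i)) j
      (rotation J t (e j))) = Complex.exp (t * Complex.I) * α + Complex.exp (-(t * Complex.I)) * β := by
    intro t
    have e1 : Function.update (fun i => rotation J (θ i) (e i)) j (rotation J t (e j)) =
        fun i => rotation J (Function.update θ j t i) (e i) := by
      ext i
      by_cases hi : i = j
      · subst hi; simp
      · simp [hi]
    have e2 : (fun i => rotationPair (Function.update θ j t i)) =
        Function.update (fun i => rotationPair (θ i)) j (rotationPair t) := by
      ext i : 1
      by_cases hi : i = j
      · subst hi; simp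
      · simp [hi]
    rw [e1, ← frameForm_rotationPair, e2, rotationPair, multilinear_update_pair]
  have hA : Ω (fun i => rotation J (θ i) (e i)) = u * α + w * β := by
    rw [← hval, Function.update_eq_self]
  have hB : Ω (Function.update (fun i => rotation J (θ i) (e i)) j (J (rotation J (θ j) (e j)))) =
      Complex.I * (u * α - w * β) := by
    rw [J_rotation hJ, hval]
    have h1 : Complex.exp (((θ j + Real.pi / 2 : ℝ) : ℂ) * Complex.I) = Complex.I * u := by
      rw [show ((θ j + Real.pi / 2 : ℝ) : ℂ) * Complex.I =
        (Real.pi / 2 : ℂ) * Complex.I + θ j * Complex.I by push_cast; ring, Complex.exp_add,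
        Complex.exp_pi_div_two_mul_I]
    rw [Complex.exp_neg, h1, mul_inv, Complex.inv_I, hu, ← Complex.exp_neg, ← hw]
    ring
  rw [hA, hB] at hpos
  have hnorm : ‖w * β‖ ^ 2 < ‖u * α‖ ^ 2 := by
    rw [← Complex.normSq_eq_norm_sq, ← Complex.normSq_eq_norm_sq, Complex.normSq_apply,
      Complex.normSq_apply]
    generalize u * α = a at hpos ⊢
    generalize w * β = b at hpos ⊢
    simp at hpos
    nlinarith
  have hu1 : ‖u‖ = 1 := Complex.norm_exp_ofReal_mul_I _
  have hw1 : ‖w‖ = 1 := by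
    rw [hw, ← neg_mul, ← Complex.ofReal_neg]
    exact Complex.norm_exp_ofReal_mul_I _
  rw [norm_mul, norm_mul, hu1, hw1, one_mul, one_mul] at hnorm
  exact lt_of_pow_lt_pow_left₀ 2 (norm_nonneg _) hnorm

theorem frameForm_ne_zero (hJ : IsCompatible ω J) (hΩ : Ω ∈ UPlus ω n)
    (he : IsSymplecticBasis ω e (fun i => J (e i))) {w : ℂ} (hw : ‖w‖ ≤ 1) :
    frameForm J Ω e (fun _ => (1, w)) ≠ 0 := by
  refine multilinear_ne_zero_of_torus _ (continuous_frameForm J Ω e) ?_ ?_ _ (by simpa using hw)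
  · intro x hx
    choose c θ hc hp using fun i => exists_eq_smul_rotationPair (hx i).1 (hx i).2
    obtain rfl : x = fun i => c i • rotationPair (θ i) := funext hp
    rw [MultilinearMap.map_smul_univ, frameForm_rotationPair]
    exact smul_ne_zero (Finset.prod_ne_zero_iff.2 fun i _ => hc i)
      (apply_ne_zero_of_mem_U hΩ.1 (he.rotate hJ θ))
  · intro x j hx
    choose c θ hc hp using fun i => exists_eq_smul_rotationPair (hx i).1 (hx i).2
    obtain rfl : x = fun i => c i • rotationPair (θ i) := funext hp
    -- The pair inserted at `j` is not rescaled, hence the factor 1 there.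
    have e1 : ∀ p, Function.update (fun i => c i • rotationPair (θ i)) j p =
        fun i => Function.update c j 1 i •
          Function.update (fun i => rotationPair (θ i)) j p i := by
      intro p
      ext i : 1
      by_cases hi : i = j
      · subst hi; simp
      · simp [hi]
    rw [e1, e1, MultilinearMap.map_smul_univ, MultilinearMap.map_smul_univ, norm_smul, norm_smul]
    refine mul_lt_mul_of_pos_left (frameForm_update_norm_lt hJ hΩ he θ j)
      (norm_pos_iff.2 (Finset.prod_ne_zero_iff.2 fun i _ => ?_))
    by_cases hi : i = j
    · subst hi; simp
    · simpa [hi] using hc i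

end Roots

theorem infinite_norm_eq_one : {w : ℂ | ‖w‖ = 1}.Infinite := by
  have h : {w : ℂ | ‖w‖ = 1} = Metric.sphere (0 : ℂ) 1 := by ext; simp
  rw [h]
  have : (Metric.sphere (0 : ℂ) 1).Nontrivial := ⟨1, by simp, -1, by simp, by norm_num⟩
  exact (isPreconnected_sphere (by simp [Complex.rank_real_complex]) 0 1).infinite_of_nontrivial this

/-- On the unit circle `(1, w) = e^{-iθ} (e^{iθ}, e^{-iθ})` with `w = e^{-2iθ}`. The scalars
contribute `e^{-inθ}` and type `(k, n-k)` contributes `e^{i(2k-n)θ}`, in total `w^(n-k)`. Both sides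
are polynomials in `w`, so agreement on the circle suffices. -/
theorem frameForm_eq_sum [FiniteDimensional ℝ V] {ω : V [⋀^Fin 2]→ₗ[ℝ] ℝ} {J : V →ₗ[ℝ] V}
    (hJ : IsCompatible ω J) (Ω : V [⋀^Fin n]→ₗ[ℝ] ℂ) (e : Fin n → V) (w : ℂ) :
    frameForm J Ω e (fun _ => (1, w)) =
      ∑ k : Fin (n + 1), w ^ (n - (k : ℕ)) * typeComponent J k Ω e := by
  have circle : ∀ w : ℂ, ‖w‖ = 1 → frameForm J Ω e (fun _ => (1, w)) =
      ∑ k : Fin (n + 1), w ^ (n - (k : ℕ)) * typeComponent J k Ω e := by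
    intro w hw
    obtain ⟨c, θ, hc, hp⟩ := exists_eq_smul_rotationPair (p := (1, w)) (by simpa using hw)
      one_ne_zero
    have hc1 : 1 = c * Complex.exp (θ * Complex.I) := congrArg Prod.fst hp
    have hcw : w = c * Complex.exp (-(θ * Complex.I)) := congrArg Prod.snd hp
    have hcθ : c = Complex.exp (-(θ * Complex.I)) := by
      rw [Complex.exp_neg]; exact eq_inv_of_mul_eq_one_left hc1.symm
    rw [hp, MultilinearMap.map_smul_univ, frameForm_rotationPair J Ω e fun _ => θ]
    have h1 : (Ω fun j => rotation J θ (e j)) =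
        ∑ k : Fin (n + 1), typeCharacter n k θ * typeComponent J k Ω e := by
      conv_lhs => rw [← sum_typeComponent hJ Ω]
      rw [form_sum_apply]
      refine Finset.sum_congr rfl fun k _ => ?_
      have := comp_rotation_of_mem_typeForms (typeComponent_mem hJ k.2 Ω) θ
      exact congrArg (fun A : V [⋀^Fin n]→ₗ[ℝ] ℂ => A e) this
    rw [h1, smul_eq_mul, Finset.mul_sum]
    refine Finset.sum_congr rfl fun k _ => ?_
    rw [← mul_assoc]
    congr 1
    rw [hcw, hcθ, Finset.prod_const, Finset.card_univ, Fintype.card_fin, ← Complex.exp_add,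
      ← Complex.exp_nat_mul, ← Complex.exp_nat_mul, typeCharacter, ← Complex.exp_add,
      Nat.cast_sub (Nat.lt_succ_iff.1 k.2)]
    congr 1
    ring
  let P : Polynomial ℂ := ∑ s : Finset (Fin n),
    Polynomial.C (Ω (s.piecewise e fun i => J (e i))) * ∏ j, if j ∈ s
      then Polynomial.C 2⁻¹ * (1 + Polynomial.X)
      else Polynomial.C (-(Complex.I / 2)) * (1 - Polynomial.X)
  let Q : Polynomial ℂ := ∑ k : Fin (n + 1),
    Polynomial.X ^ (n - (k : ℕ)) * Polynomial.C (typeComponent J k Ω e)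
  have hP : ∀ w, P.eval w = frameForm J Ω e (fun _ => (1, w)) := by
    intro w
    rw [frameForm_apply, Polynomial.eval_finsetSum]
    refine Finset.sum_congr rfl fun s _ => ?_
    rw [Polynomial.eval_mul, Polynomial.eval_C, Polynomial.eval_prod]
    congr 1
    refine Finset.prod_congr rfl fun j _ => ?_
    split_ifs <;> simp
  have hQ : ∀ w, Q.eval w = ∑ k : Fin (n + 1), w ^ (n - (k : ℕ)) * typeComponent J k Ω e := by
    intro w
    simp only [Q, Polynomial.eval_finsetSum, Polynomial.eval_mul, Polynomial.eval_pow,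
      Polynomial.eval_X, Polynomial.eval_C]
  have hPQ : P = Q := Polynomial.eq_of_infinite_eval_eq P Q
    (infinite_norm_eq_one.mono fun w hw => by
      rw [Set.mem_ofPred_eq, hP, hQ]
      exact circle w hw)
  rw [← hP, hPQ, hQ]

/-! ### Forms of type `(n, 0)` -/

section TopType

variable {ω : V [⋀^Fin 2]→ₗ[ℝ] ℝ} {J : V →ₗ[ℝ] V} {e f : Fin n → V} {Ω : V [⋀^Fin n]→ₗ[ℝ] ℂ}

theorem apply_piecewise_J (hΩ : Ω ∈ typeForms J n n) (w : Fin n → V) (s : Finset (Fin n)) :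
    Ω (s.piecewise (fun i => J (w i)) w) = Complex.I ^ s.card * Ω w := by
  induction s using Finset.induction_on with
  | empty => simp
  | insert a s ha ih =>
    rw [Finset.piecewise_insert, apply_update_J_of_mem_typeForms hΩ, Finset.card_insert_of_notMem ha,
      pow_succ', mul_assoc, ← ih]
    congr 2
    rw [Function.update_eq_iff]
    exact ⟨by simp [ha], fun _ _ => rfl⟩

theorem exists_apply_elim_eq_mul (hΩ : Ω ∈ typeForms J n n) (e : Fin n → V)
    (p : Fin n → Fin n ⊕ Fin n) :
    ∃ c : ℂ, (Ω fun i => Sum.elim e (fun j => J (e j)) (p i)) =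
      c * Ω fun i => e (Sum.elim id id (p i)) := by
  refine ⟨_, Eq.trans (congrArg Ω ?_) (apply_piecewise_J hΩ (fun i => e (Sum.elim id id (p i)))
    (Finset.univ.filter fun i => (p i).isRight))⟩
  ext i
  cases hp : p i <;> simp [hp]

/-- By complex linearity, every value on vectors `e_j`, `J e_j` is a multiple of a value on the
`e_j` alone. Hence the `(n, 0)`-forms are at most a complex line. -/
theorem eq_zero_of_apply_eq_zero [NeZero n] (hV : Module.finrank ℝ V = 2 * n)
    (he : IsSymplecticBasis ω e (fun i => J (e i))) (hΩ : Ω ∈ typeForms J n n) (h0 : Ω e = 0) :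
    Ω = 0 := by
  refine (he.basis hV).ext_alternating fun p _ => ?_
  rw [he.coe_basis hV]
  obtain ⟨c, hc⟩ := exists_apply_elim_eq_mul hΩ e p
  rw [hc]
  by_cases hinj : Function.Injective fun i => Sum.elim id id (p i)
  · have := Ω.map_perm e (Equiv.ofBijective _ (Finite.injective_iff_bijective.1 hinj))
    rw [h0, smul_zero] at this
    rw [show (Ω fun i => e (Sum.elim id id (p i))) = 0 from this]
    simp
  · rw [Ω.map_eq_zero_of_not_injective _ fun h => hinj fun i j hij => h (congrArg e hij)]
    simp

/-- In a term of the wedge on basis vectors, `ω` vanishes unless it receives `e_k` and `J e_k`. Then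
`Ω` receives `n` vectors whose indices avoid `k`, so two of them are complex proportional and `Ω`
vanishes. -/
theorem isPrimitive_of_mem_typeForms [NeZero n] (hV : Module.finrank ℝ V = 2 * n)
    (he : IsSymplecticBasis ω e (fun i => J (e i))) (hΩ : Ω ∈ typeForms J n n) :
    IsPrimitive ω Ω := by
  refine (he.basis hV).ext_alternating fun p hp => ?_
  rw [he.coe_basis hV, wedge_apply]
  refine Finset.sum_eq_zero fun q _ => ?_
  set r : Fin 2 ⊕ Fin n → Fin n ⊕ Fin n := fun i => p (q.out i) with hr
  have hri : Function.Injective r := hp.comp q.out.injective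
  have hω : (ω fun i => Sum.elim e (fun j => J (e j)) (r (Sum.inl i))) =
      toBilin ω (Sum.elim e (fun j => J (e j)) (r (Sum.inl 0)))
        (Sum.elim e (fun j => J (e j)) (r (Sum.inl 1))) := by
    rw [toBilin_apply]
    congr 1
    ext i
    fin_cases i <;> rfl
  change Equiv.Perm.sign q.out •
    (ω fun i => Sum.elim e (fun j => J (e j)) (r (Sum.inl i))) •
      (Ω fun i => Sum.elim e (fun j => J (e j)) (r (Sum.inr i))) = (0 : ℂ)
  by_cases hk : Sum.elim id id (r (Sum.inl 0)) = Sum.elim id id (r (Sum.inl 1))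
  · obtain ⟨c, hc⟩ := exists_apply_elim_eq_mul hΩ e fun i => r (Sum.inr i)
    rw [hc, Ω.map_eq_zero_of_not_injective, mul_zero, smul_zero, smul_zero]
    intro hinj
    have hinj' : Function.Injective fun i => (Sum.elim id id (r (Sum.inr i)) : Fin n) :=
      fun i j hij => hinj (congrArg e hij)
    -- Distinct indices would exhaust `Fin n` and hit `k` a third time, but only two basis vectors
    -- have index `k`.
    obtain ⟨i, hi⟩ := Finite.injective_iff_surjective.1 hinj' (Sum.elim id id (r (Sum.inl 0)))
    have h01 : r (Sum.inl 0) ≠ r (Sum.inl 1) := hri.ne (by simp)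
    have h0i : r (Sum.inl 0) ≠ r (Sum.inr i) := hri.ne (by simp)
    have h1i : r (Sum.inl 1) ≠ r (Sum.inr i) := hri.ne (by simp)
    have fiber : ∀ a b c : Fin n ⊕ Fin n, (Sum.elim id id a : Fin n) = Sum.elim id id b →
        (Sum.elim id id c : Fin n) = Sum.elim id id a → a ≠ b → a ≠ c → b = c := by
      rintro (a | a) (b | b) (c | c) <;> simp +contextual
    exact h1i (fiber _ _ _ hk hi h01 h0i)
  · rw [hω]
    have : toBilin ω (Sum.elim e (fun j => J (e j)) (r (Sum.inl 0)))
        (Sum.elim e (fun j => J (e j)) (r (Sum.inl 1))) = 0 := by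
      generalize r (Sum.inl 0) = a at *
      generalize r (Sum.inl 1) = b at *
      rcases a with a | a <;> rcases b with b | b <;>
        simp_all [he.bilin_ee, he.bilin_ff, he.bilin_ef, he.bilin_fe]
    simp [this]

/-- The form `dz_1 ∧ … ∧ dz_n`, in the complex coordinates of `(V, J)` given by the basis `e`. -/
theorem exists_mem_typeForms_apply_eq_one (hJ : IsCompatible ω J)
    (he : IsSymplecticBasis ω e (fun i => J (e i))) : ∃ Ω ∈ typeForms J n n, Ω e = 1 := by
  let ℓ : Fin n → V →ₗ[ℝ] ℂ := fun j =>
    (Algebra.linearMap ℝ ℂ).comp ((toBilin ω (e j)).comp J) +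
      Complex.I • (Algebra.linearMap ℝ ℂ).comp ((toBilin ω (J (e j))).comp J)
  have hℓ : ∀ j x, ℓ j x = (toBilin ω (e j) (J x) : ℂ) +
      Complex.I * (toBilin ω (J (e j)) (J x) : ℂ) := fun j x => rfl
  refine ⟨wedgeOneForms ℓ, Submodule.subset_span ⟨ℓ, Finset.univ, by simp, fun i _ x => ?_,
    fun i hi => absurd (Finset.mem_univ i) hi, rfl⟩, ?_⟩
  · rw [hℓ, hℓ, hJ.sq_eq_neg, hJ.bilin_invariant, map_neg, map_neg, hJ.bilin_apply_left]
    push_cast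
    linear_combination (-(toBilin ω (e i) x : ℂ)) * Complex.I_mul_I
  · rw [wedgeOneForms_apply]
    have : (Matrix.of fun i j => ℓ j (e i)) = 1 := by
      ext i j
      rw [Matrix.of_apply, hℓ, hJ.bilin_invariant, he.bilin_ee, he.bilin_ef, Matrix.one_apply]
      by_cases hij : i = j
      · simp [hij]
      · simp [hij, Ne.symm hij]
    rw [this, Matrix.det_one]

theorem apply_update_mem_span (Ω : V [⋀^Fin n]→ₗ[ℝ] ℂ) (e : Fin n → V) (i : Fin n)
    (c : Fin n → ℝ) : Ω (Function.update e i (∑ j, c j • e j)) = c i • Ω e := by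
  rw [AlternatingMap.map_update_sum, Finset.sum_eq_single i]
  · rw [AlternatingMap.map_update_smul, Function.update_eq_self]
  · intro j _ hj
    rw [AlternatingMap.map_update_smul, Ω.map_update_self e hj.symm, smul_zero]
  · simp

/-- For the span `L` of `e`, `V = L ⊕ J L`. Write `f 0 = x + J y` with `x, y` in `L`, having `0`-th
coordinates `a 0, b 0`. Then `f 0` contributes the factor `a 0 + i b 0`, and `b 0 = ω(y, Jy) > 0`
because `ω(e_i, Jy) = ω(e_i, f 0)`. -/
theorem im_pos_of_mem_typeForms [NeZero n] (hV : Module.finrank ℝ V = 2 * n)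
    (hJ : IsCompatible ω J) (h : IsSymplecticBasis ω e f) (hΩ : Ω ∈ typeForms J n n)
    (h0 : Ω e ≠ 0) : 0 < (conj (Ω e) * Ω (Function.update e 0 (f 0))).im := by
  obtain ⟨u, hu, hu'⟩ := (stdLagrangian h 0).exists_unitary_frame hJ
  have hspan : Submodule.span ℝ (Set.range u) = Submodule.span ℝ (Set.range e) :=
    hu.trans (congrArg (fun v : Fin n → V => Submodule.span ℝ (Set.range v)) (stdFrame_zero e f))
  have hdec : ∃ x ∈ Submodule.span ℝ (Set.range e), ∃ y ∈ Submodule.span ℝ (Set.range e),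
      f 0 = x + J y := by
    have htop : f 0 ∈ Submodule.span ℝ (Set.range (Sum.elim u fun i => J (u i))) := by
      rw [← hu'.coe_basis hV, Module.Basis.span_eq]
      exact Submodule.mem_top
    rw [Set.Sum.elim_range, Submodule.span_union, Submodule.mem_sup] at htop
    obtain ⟨x, hx, z, hz, hxz⟩ := htop
    have hz' : z ∈ (Submodule.span ℝ (Set.range u)).map J := by
      rw [Submodule.map_span, ← Set.range_comp]
      exact hz
    obtain ⟨y, hy, rfl⟩ := hz'
    exact ⟨x, hspan ▸ hx, y, hspan ▸ hy, hxz.symm⟩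
  obtain ⟨x, hx, y, hy, hf⟩ := hdec
  obtain ⟨a, rfl⟩ := (Submodule.mem_span_range_iff_exists_fun ℝ).1 hx
  obtain ⟨b, hb⟩ := (Submodule.mem_span_range_iff_exists_fun ℝ).1 hy
  have hval : Ω (Function.update e 0 (f 0)) = (a 0 + b 0 * Complex.I) * Ω e := by
    rw [hf, AlternatingMap.map_update_add, apply_update_J_of_mem_typeForms hΩ, ← hb,
      apply_update_mem_span, apply_update_mem_span, Complex.real_smul, Complex.real_smul]
    ring
  have hey : ∀ i, toBilin ω (e i) (J y) = if i = 0 then 1 else 0 := by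
    intro i
    rw [← h.bilin_ef, hf, map_add, map_sum]
    simp [h.bilin_ee]
  have hyy : toBilin ω y (J y) = b 0 := by
    have : toBilin ω y = ∑ i, b i • toBilin ω (e i) := by rw [← hb, map_sum]; simp
    simp [this, LinearMap.sum_apply, hey]
  have hb0 : 0 < b 0 := by
    rw [← hyy]
    refine hJ.pos y fun hy0 => ?_
    have := hey 0
    simp [hy0] at this
  have : (conj (Ω e) * Ω (Function.update e 0 (f 0))).im = b 0 * Complex.normSq (Ω e) := by
    rw [hval, Complex.normSq_apply]
    simp
    ring
  rw [this]
  exact mul_pos hb0 (Complex.normSq_pos.2 h0)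

theorem mem_UPlus_of_mem_typeForms [NeZero n] (hV : Module.finrank ℝ V = 2 * n)
    (hJ : IsCompatible ω J) (hΩ : Ω ∈ typeForms J n n) (h0 : Ω ≠ 0) : Ω ∈ UPlus ω n := by
  have : FiniteDimensional ℝ V := FiniteDimensional.of_finrank_pos (by
    rw [hV]; have := Nat.pos_of_ne_zero (NeZero.ne n); omega)
  obtain ⟨e, he⟩ := hJ.exists_unitary_frame n hV.ge
  have hU : Ω ∈ U ω n := mem_U_of_unitary_frames hJ (isPrimitive_of_mem_typeForms hV he hΩ)
    fun e he hz => h0 (eq_zero_of_apply_eq_zero hV he hΩ hz)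
  exact mem_UPlus_iff.2 ⟨hU, fun e f h =>
    im_pos_of_mem_typeForms hV hJ h hΩ (apply_ne_zero_of_mem_U hU h)⟩

end TopType

/-! ### The deformation -/

/-- A space is homotopy equivalent to the circle if it maps to `ℂ ∖ {0}` and contracts to a section
over the circle. -/
theorem nonempty_homotopyEquiv_circle_of_retraction {X : Type*} [TopologicalSpace X] (a : C(X, ℂ))
    (ha : ∀ x, a x ≠ 0) (g : C(Circle, X)) (hag : ∀ c : Circle, a (g c) = c) (K : C(I × X, X))
    (h0 : ∀ x (c : Circle), (c : ℂ) = a x / ‖a x‖ → K (0, x) = g c) (h1 : ∀ x, K (1, x) = x) :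
    Nonempty (ContinuousMap.HomotopyEquiv X Circle) := by
  let F : C(X, Circle) :=
    ⟨fun x => ⟨a x / ‖a x‖, mem_sphere_zero_iff_norm.2 (by simp [ha x])⟩,
      Continuous.subtype_mk (a.continuous.div (Complex.continuous_ofReal.comp a.continuous.norm)
        fun x => by simpa using ha x) _⟩
  have hF : ∀ x, (F x : ℂ) = a x / ‖a x‖ := fun x => rfl
  refine ⟨⟨F, g, ⟨⟨K, fun x => h0 x _ (hF x), h1⟩⟩, ?_⟩⟩
  have hFg : F.comp g = ContinuousMap.id Circle := by
    refine ContinuousMap.ext fun c => Circle.ext ?_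
    rw [ContinuousMap.comp_apply, hF, hag, Circle.norm_coe, Complex.ofReal_one, div_one]
    rfl
  rw [hFg]

section Deformation

variable {ω : V [⋀^Fin 2]→ₗ[ℝ] ℝ} {J : V →ₗ[ℝ] V} {Ω : V [⋀^Fin n]→ₗ[ℝ] ℂ}

/-- The form obtained by scaling the component of type `(k, n - k)` by `s ^ (n - k)`. -/
def scaleTypes (J : V →ₗ[ℝ] V) (s : ℝ) (Ω : V [⋀^Fin n]→ₗ[ℝ] ℂ) : V [⋀^Fin n]→ₗ[ℝ] ℂ :=
  ∑ k : Fin (n + 1), (s : ℂ) ^ (n - (k : ℕ)) • typeComponent J k Ω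

theorem scaleTypes_apply (J : V →ₗ[ℝ] V) (s : ℝ) (Ω : V [⋀^Fin n]→ₗ[ℝ] ℂ) (v : Fin n → V) :
    scaleTypes J s Ω v = ∑ k : Fin (n + 1), (s : ℂ) ^ (n - (k : ℕ)) * typeComponent J k Ω v := by
  simp [scaleTypes, form_sum_apply]

theorem scaleTypes_one [FiniteDimensional ℝ V] (hJ : IsCompatible ω J) (Ω : V [⋀^Fin n]→ₗ[ℝ] ℂ) :
    scaleTypes J 1 Ω = Ω := by
  simp [scaleTypes, sum_typeComponent hJ]

theorem scaleTypes_zero (J : V →ₗ[ℝ] V) (Ω : V [⋀^Fin n]→ₗ[ℝ] ℂ) :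
    scaleTypes J 0 Ω = typeComponent J n Ω := by
  -- The term `k = n` survives because its factor is `0 ^ 0 = 1`.
  rw [scaleTypes, Finset.sum_eq_single (Fin.last n)]
  · simp
  · intro k _ hk
    have : (k : ℕ) < n := lt_of_le_of_ne (Nat.lt_succ_iff.1 k.2) fun h => hk (Fin.ext h)
    rw [Complex.ofReal_zero, zero_pow (by omega), zero_smul]
  · simp

theorem scaleTypes_of_mem (s : ℝ) (hΩ : Ω ∈ typeForms J n n) : scaleTypes J s Ω = Ω := by
  rw [scaleTypes, Finset.sum_eq_single (Fin.last n)]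
  · rw [typeComponent_of_mem n.lt_succ_self (Fin.last n).2 hΩ]
    simp
  · intro k _ hk
    rw [typeComponent_of_mem n.lt_succ_self k.2 hΩ, if_neg fun h => hk (Fin.ext h.symm), smul_zero]
  · simp

theorem continuous_scaleTypes : Continuous fun p : ℝ × (V [⋀^Fin n]→ₗ[ℝ] ℂ) =>
    scaleTypes J p.1 p.2 := by
  refine continuous_form_iff.2 fun v => ?_
  simp only [scaleTypes_apply]
  refine continuous_finsetSum _ fun k _ => ?_
  exact ((Complex.continuous_ofReal.comp continuous_fst).pow _).mul
    ((continuous_typeComponent k v).comp continuous_snd)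

theorem typePolynomial_eval (c : Fin (n + 1) → V [⋀^Fin n]→ₗ[ℝ] ℂ) (v : Fin n → V) (z : ℂ) :
    (typePolynomial c v).eval z = ∑ k : Fin (n + 1), c k v * z ^ (k : ℕ) := by
  simp [typePolynomial, Polynomial.eval_finsetSum]

theorem typePolynomial_natDegree {c : Fin (n + 1) → V [⋀^Fin n]→ₗ[ℝ] ℂ} {v : Fin n → V}
    (h : c (Fin.last n) v ≠ 0) : (typePolynomial c v).natDegree = n := by
  refine Polynomial.natDegree_eq_of_le_of_coeff_ne_zero ?_ ?_
  · exact Polynomial.natDegree_sum_le_of_forall_le _ _ fun k _ =>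
      (Polynomial.natDegree_C_mul_X_pow_le _ _).trans (Nat.lt_succ_iff.1 k.2)
  · rw [typePolynomial, Polynomial.finsetSum_coeff, Finset.sum_eq_single (Fin.last n)]
    · simpa using h
    · intro k _ hk
      rw [Polynomial.coeff_C_mul_X_pow, if_neg fun h => hk (Fin.ext h.symm)]
    · simp

variable [NeZero n]

theorem smul_mem_UPlus (hΩ : Ω ∈ UPlus ω n) {c : ℂ} (hc : c ≠ 0) : c • Ω ∈ UPlus ω n := by
  refine mem_UPlus_iff.2 ⟨⟨?_, fun L h => hΩ.1.2 L ?_⟩, fun e f h => ?_⟩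
  · change wedgeLeft ω (c • Ω) = 0
    rw [map_smul, show wedgeLeft ω Ω = 0 from hΩ.1.1, smul_zero]
  · have h' : c • Ω.compLinearMap L.1.subtype = 0 := h
    exact (smul_eq_zero.1 h').resolve_left hc
  · have := mul_pos (Complex.normSq_pos.2 hc) ((mem_UPlus_iff.1 hΩ).2 e f h)
    simp only [AlternatingMap.smul_apply, smul_eq_mul, map_mul]
    rw [show conj c * conj (Ω e) * (c * Ω (Function.update e 0 (f 0))) =
      (Complex.normSq c : ℂ) * (conj (Ω e) * Ω (Function.update e 0 (f 0))) by
        rw [← Complex.mul_conj]; ring, Complex.im_ofReal_mul]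
    exact this

variable [FiniteDimensional ℝ V]

theorem sum_pow_mul_typeComponent_ne_zero (hJ : IsCompatible ω J) (hΩ : Ω ∈ UPlus ω n)
    {e : Fin n → V} (he : IsSymplecticBasis ω e (fun i => J (e i))) {w : ℂ} (hw : ‖w‖ ≤ 1) :
    ∑ k : Fin (n + 1), w ^ (n - (k : ℕ)) * typeComponent J k Ω e ≠ 0 := by
  rw [← frameForm_eq_sum hJ]
  exact frameForm_ne_zero hJ hΩ he hw

theorem scaleTypes_mem_U (hJ : IsCompatible ω J) (hΩ : Ω ∈ UPlus ω n) {s : ℝ}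
    (hs : s ∈ Set.Icc (0 : ℝ) 1) : scaleTypes J s Ω ∈ U ω n := by
  refine mem_U_of_unitary_frames hJ ?_ fun e he => ?_
  · change wedgeLeft ω (scaleTypes J s Ω) = 0
    rw [scaleTypes, map_sum]
    refine Finset.sum_eq_zero fun k _ => ?_
    have : wedgeLeft ω (typeComponent J k Ω) = 0 := isPrimitive_typeComponent hJ hΩ.1.1 k
    rw [map_smul, this, smul_zero]
  · rw [scaleTypes_apply]
    refine sum_pow_mul_typeComponent_ne_zero hJ hΩ he ?_
    rw [Complex.norm_real, Real.norm_of_nonneg hs.1]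
    exact hs.2

/-- The path stays in `𝒰(V)`, so the imaginary part in `mem_UPlus_iff` never vanishes and keeps its
sign from `s = 1`. The parameter is reversed to start there. -/
theorem scaleTypes_mem_UPlus (hJ : IsCompatible ω J) (hΩ : Ω ∈ UPlus ω n) {s : ℝ}
    (hs : s ∈ Set.Icc (0 : ℝ) 1) : scaleTypes J s Ω ∈ UPlus ω n := by
  refine mem_UPlus_iff.2 ⟨scaleTypes_mem_U hJ hΩ hs, fun e f h => ?_⟩
  have hc : ∀ v, Continuous fun t : ℝ => scaleTypes J (1 - t) Ω v := fun v =>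
    (continuous_apply_form v).comp (continuous_scaleTypes.comp
      ((continuous_const.sub continuous_id).prodMk continuous_const))
  have := pos_of_continuous_of_ne_zero (g := fun t : ℝ =>
    (conj (scaleTypes J (1 - t) Ω e) * scaleTypes J (1 - t) Ω (Function.update e 0 (f 0))).im)
    (Complex.continuous_im.comp ((Complex.continuous_conj.comp (hc _)).mul (hc _)))
    (fun t ht => im_ne_zero_of_mem_U
      (scaleTypes_mem_U hJ hΩ ⟨by linarith [ht.2], by linarith [ht.1]⟩) h)
    (by simpa [scaleTypes_one hJ] using (mem_UPlus_iff.1 hΩ).2 e f h)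
    (s := 1 - s) ⟨by linarith [hs.2], by linarith [hs.1]⟩
  simpa using this

theorem typeComponent_apply_ne_zero (hJ : IsCompatible ω J) (hΩ : Ω ∈ UPlus ω n)
    {e : Fin n → V} (he : IsSymplecticBasis ω e (fun i => J (e i))) : typeComponent J n Ω e ≠ 0 := by
  rw [← scaleTypes_zero]
  exact apply_ne_zero_of_mem_U (scaleTypes_mem_U hJ hΩ (by simp)) he

theorem deformationRetractsTo (hV : Module.finrank ℝ V = 2 * n) (hJ : IsCompatible ω J) :
    DeformationRetractsTo (UPlus ω n) {Ω : V [⋀^Fin n]→ₗ[ℝ] ℂ | Ω ∈ typeForms J n n ∧ Ω ≠ 0} := by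
  have hs : ∀ t : I, 1 - (t : ℝ) ∈ Set.Icc (0 : ℝ) 1 := fun t =>
    ⟨by linarith [t.2.2], by linarith [t.2.1]⟩
  obtain ⟨e, he⟩ := hJ.exists_unitary_frame n hV.ge
  refine ⟨fun Ω hΩ => mem_UPlus_of_mem_typeForms hV hJ hΩ.1 hΩ.2,
    ⟨fun p => ⟨scaleTypes J (1 - p.1) p.2, scaleTypes_mem_UPlus hJ p.2.2 (hs p.1)⟩, ?_⟩,
    fun Ω => ?_, fun Ω => ?_, fun t Ω hΩ => ?_⟩
  · refine Continuous.subtype_mk (continuous_scaleTypes.comp (Continuous.prodMk ?_ ?_)) _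
    · exact continuous_const.sub (continuous_subtype_val.comp continuous_fst)
    · exact continuous_subtype_val.comp continuous_snd
  · exact Subtype.ext (by simp [scaleTypes_one hJ])
  · have hz : scaleTypes J (1 - ((1 : I) : ℝ)) (Ω : V [⋀^Fin n]→ₗ[ℝ] ℂ) = typeComponent J n Ω := by
      simp [scaleTypes_zero]
    refine ⟨?_, fun h0 => ?_⟩
    · change scaleTypes J (1 - ((1 : I) : ℝ)) (Ω : V [⋀^Fin n]→ₗ[ℝ] ℂ) ∈ typeForms J n n
      rw [hz]
      exact typeComponent_mem hJ n.lt_succ_self _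
    · refine typeComponent_apply_ne_zero hJ Ω.2 he ?_
      rw [← hz]
      exact congrArg (fun A : V [⋀^Fin n]→ₗ[ℝ] ℂ => A e) h0
  · exact Subtype.ext (scaleTypes_of_mem _ hΩ.1)

theorem nonempty_homotopyEquiv_circle (hV : Module.finrank ℝ V = 2 * n) (hJ : IsCompatible ω J) :
    Nonempty (ContinuousMap.HomotopyEquiv (UPlus ω n) Circle) := by
  obtain ⟨e, he⟩ := hJ.exists_unitary_frame n hV.ge
  obtain ⟨Ω₀, hΩ₀, hΩ₀e⟩ := exists_mem_typeForms_apply_eq_one hJ he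
  have hΩ₀U : Ω₀ ∈ UPlus ω n := mem_UPlus_of_mem_typeForms hV hJ hΩ₀ fun h => by simp [h] at hΩ₀e
  have htop : ∀ Ω : V [⋀^Fin n]→ₗ[ℝ] ℂ, typeComponent J n Ω = typeComponent J n Ω e • Ω₀ := by
    intro Ω
    refine sub_eq_zero.1 (eq_zero_of_apply_eq_zero hV he (Submodule.sub_mem _
      (typeComponent_mem hJ n.lt_succ_self Ω) (Submodule.smul_mem _ _ hΩ₀)) ?_)
    simp [hΩ₀e]
  obtain ⟨a, ha'⟩ : ∃ a : C(UPlus ω n, ℂ),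
      ∀ Ω, a Ω = typeComponent J n (Ω : V [⋀^Fin n]→ₗ[ℝ] ℂ) e :=
    ⟨⟨_, (continuous_typeComponent n e).comp continuous_subtype_val⟩, fun _ => rfl⟩
  have ha : ∀ Ω, a Ω ≠ 0 := fun Ω => by
    rw [ha']
    exact typeComponent_apply_ne_zero hJ Ω.2 he
  obtain ⟨g, hg⟩ : ∃ g : C(Circle, UPlus ω n),
      ∀ c, (g c : V [⋀^Fin n]→ₗ[ℝ] ℂ) = (c : ℂ) • Ω₀ := by
    have hc : Continuous fun c : Circle => (c : ℂ) • Ω₀ := continuous_form_iff.2 fun v =>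
      Continuous.mul (continuous_subtype_val (p := fun z : ℂ => z ∈ Submonoid.unitSphere ℂ))
        continuous_const
    exact ⟨⟨fun c => ⟨(c : ℂ) • Ω₀, smul_mem_UPlus hΩ₀U c.coe_ne_zero⟩, hc.subtype_mk _⟩,
      fun _ => rfl⟩
  -- The factor `|a|^(t-1)` normalizes the end `t = 0` to `(a / |a|) Ω₀`, a point of the section,
  -- and is 1 at `t = 1`.
  obtain ⟨K, hK⟩ : ∃ K : C(I × UPlus ω n, UPlus ω n), ∀ p, (K p : V [⋀^Fin n]→ₗ[ℝ] ℂ) =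
      ((‖a p.2‖ ^ ((p.1 : ℝ) - 1) : ℝ) : ℂ) • scaleTypes J (p.1 : ℝ) p.2 := by
    have hr : ∀ p : I × UPlus ω n, ((‖a p.2‖ ^ ((p.1 : ℝ) - 1) : ℝ) : ℂ) ≠ 0 := fun p =>
      Complex.ofReal_ne_zero.2 (Real.rpow_pos_of_pos (norm_pos_iff.2 (ha p.2)) _).ne'
    have hrc : Continuous fun p : I × UPlus ω n => ((‖a p.2‖ ^ ((p.1 : ℝ) - 1) : ℝ) : ℂ) :=
      Complex.continuous_ofReal.comp (((a.continuous.comp continuous_snd).norm).rpow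
        ((continuous_subtype_val.comp continuous_fst).sub continuous_const)
        fun p => Or.inl (norm_ne_zero_iff.2 (ha p.2)))
    have hsc : Continuous fun p : I × UPlus ω n =>
        scaleTypes J (p.1 : ℝ) (p.2 : V [⋀^Fin n]→ₗ[ℝ] ℂ) :=
      continuous_scaleTypes.comp ((continuous_subtype_val.comp continuous_fst).prodMk
        (continuous_subtype_val.comp continuous_snd))
    have hc : Continuous fun p : I × UPlus ω n => ((‖a p.2‖ ^ ((p.1 : ℝ) - 1) : ℝ) : ℂ) •
        scaleTypes J (p.1 : ℝ) (p.2 : V [⋀^Fin n]→ₗ[ℝ] ℂ) :=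
      continuous_form_iff.2 fun v => hrc.mul ((continuous_apply_form v).comp hsc)
    exact ⟨⟨fun p => ⟨_, smul_mem_UPlus (scaleTypes_mem_UPlus hJ p.2.2 p.1.2) (hr p)⟩,
      hc.subtype_mk _⟩, fun _ => rfl⟩
  refine nonempty_homotopyEquiv_circle_of_retraction a ha g (fun c => ?_) K
    (fun Ω c hc => Subtype.ext ?_) fun Ω => Subtype.ext ?_
  · rw [ha', hg, map_smul, typeComponent_of_mem n.lt_succ_self n.lt_succ_self hΩ₀, if_pos rfl,
      AlternatingMap.smul_apply, hΩ₀e, smul_eq_mul, mul_one]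
  · rw [hK, hg, hc, Set.Icc.coe_zero, scaleTypes_zero, zero_sub, Real.rpow_neg_one,
      div_eq_inv_mul, mul_smul, Complex.ofReal_inv, htop Ω, ← ha']
  · rw [hK, Set.Icc.coe_one, scaleTypes_one hJ, sub_self, Real.rpow_zero, Complex.ofReal_one,
      one_smul]

/-- For `z ≠ 0`, `p(z)` is a nonzero real multiple of `z^n ∑ z^{-(n-k)} Ω^{k,n-k}(e)` for a unitary
frame `e` of `L`, so no root has `|z| ≥ 1`. The leading coefficient is the case `w = 0`. -/
theorem typePolynomial_roots (hJ : IsCompatible ω J) (hΩ : Ω ∈ UPlus ω n) (L : LGr ω n)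
    {v : Fin n → V} (hv : Submodule.span ℝ (Set.range v) = L.1) :
    (typePolynomial (fun k : Fin (n + 1) => typeComponent J k Ω) v).natDegree = n ∧
      ∀ z : ℂ, (typePolynomial (fun k : Fin (n + 1) => typeComponent J k Ω) v).IsRoot z →
        ‖z‖ < 1 := by
  obtain ⟨e, heL, he⟩ := L.exists_unitary_frame hJ
  obtain ⟨r, hr, hrv⟩ := L.exists_ratio heL hv
  have hr' : (r : ℂ) ≠ 0 := Complex.ofReal_ne_zero.2 hr
  refine ⟨typePolynomial_natDegree ?_, fun z hz => ?_⟩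
  · rw [hrv]
    exact smul_ne_zero hr (typeComponent_apply_ne_zero hJ hΩ he)
  · by_contra hlt
    have hz1 : 1 ≤ ‖z‖ := not_lt.1 hlt
    have hz0 : z ≠ 0 := norm_pos_iff.1 (by linarith)
    have hw : ‖z⁻¹‖ ≤ 1 := by rw [norm_inv]; exact inv_le_one_of_one_le₀ hz1
    have h := sum_pow_mul_typeComponent_ne_zero hJ hΩ he hw
    rw [Polynomial.IsRoot, typePolynomial_eval] at hz
    apply h
    refine (mul_eq_zero.1 (Eq.trans ?_ hz)).resolve_left (mul_ne_zero hr' (pow_ne_zero n hz0))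
    rw [Finset.mul_sum]
    refine Finset.sum_congr rfl fun k _ => ?_
    have hk : z ^ n = z ^ (n - (k : ℕ)) * z ^ (k : ℕ) := by
      rw [← pow_add, Nat.sub_add_cancel (Nat.lt_succ_iff.1 k.2)]
    rw [hrv, Complex.real_smul, hk, inv_pow]
    field_simp

end Deformation

end

end LagForms

theorem mainTheorem4 {V : Type*} [AddCommGroup V] [Module ℝ V] (n : ℕ) [NeZero n]
    (hV : Module.finrank ℝ V = 2 * n) (ω : V [⋀^Fin 2]→ₗ[ℝ] ℝ) (hω : LagForms.IsSymplectic ω)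
    (J : V →ₗ[ℝ] V) (hJ : LagForms.IsCompatible ω J) :
    LagForms.DeformationRetractsTo (LagForms.UPlus ω n)
      {Ω : V [⋀^Fin n]→ₗ[ℝ] ℂ | Ω ∈ LagForms.typeForms J n n ∧ Ω ≠ 0} ∧
    Nonempty (ContinuousMap.HomotopyEquiv (LagForms.UPlus ω n) Circle) ∧
    ∀ Ω ∈ LagForms.UPlus ω n, ∃ c : Fin (n + 1) → V [⋀^Fin n]→ₗ[ℝ] ℂ,
      (∀ d, LagForms.IsTypeDecomposition J Ω d ↔ d = c) ∧
      ∀ (L : LagForms.LGr ω n) (v : Fin n → V), Submodule.span ℝ (Set.range v) = L.1 →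
        (LagForms.typePolynomial c v).natDegree = n ∧
        ∀ z : ℂ, (LagForms.typePolynomial c v).IsRoot z → ‖z‖ < 1 := by
  have : FiniteDimensional ℝ V := FiniteDimensional.of_finrank_pos (by
    rw [hV]; have := Nat.pos_of_ne_zero (NeZero.ne n); omega)
  exact ⟨LagForms.deformationRetractsTo hV hJ, LagForms.nonempty_homotopyEquiv_circle hV hJ,
    fun Ω hΩ => ⟨_, LagForms.isTypeDecomposition_iff hJ Ω,
      fun L _ hv => LagForms.typePolynomial_roots hJ hΩ L hv⟩⟩
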